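/- Setting. Let $G$ be a group with a finite index normal subgroup $G'\cong\mathbb Z^r$, $r\ge 1$; identify $G'$ with $\mathbb Z^r$. Let $R\ni 1_G$ be a set of representatives of $G/G'$ and let $m\ge 2$. For $i\ge 1$ let $\Gamma_i\le G'$ be generated by $p^i_je_j$ $(1\le j\le r)$, where for all $i,j$: $p^i_j<p^{i+1}_j$, $p^i_j\mid p^{i+1}_j$, $p^i_j>2i+1$, and $[\Gamma_i:\Gamma_{i+1}]>\frac{1}{1-1/2^{(1/2)^{i+1}}}$. Let $$D_i=\{x\in\mathbb Z^r:-q^i_{1,j}\le x_j<q^i_{2,j},\ 1\le j\le r\}\subseteq G',$$ where $q^i_{1,j},q^i_{2,j}>i$, $q^i_{1,j}+q^i_{2,j}=p^i_j$, and $D_{i+1}=\bigcup_{\gamma\in D_{i+1}\cap\Gamma_i}\gamma D_i$ for every $i\ge 1$. Let $\Sigma=\{1,\dots,m,\beta\}$ with $\beta\notin\{1,\dots,m\}$. For $n\ge1$ let $\alpha_n\in\{1,\dots,m\}$ satisfy $\alpha_n\equiv n \pmod m$. Put $J(0)=\{1_G\}$ and $J(n)=D_n\setminus\bigcup_{i=0}^{n-1}\Gamma_{i+1}J(i)$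 for $n\ge 1$. Define $\eta\in\Sigma^G$ by $\eta=\alpha_1$ on $\Gamma_1$, $\eta=\beta$ on $\Gamma_1(R\setminus\{1_G\})$, and $\eta=\alpha_{n+1}$ on $\Gamma_{n+1}J(n)R$ for $n\ge1$. Let $\sigma^g(x)(h)=x(g^{-1}h)$ be the shift and $X=\overline{\{\sigma^g\eta:g\in G\}}$. For $x\in\Sigma^G$ and $\alpha\in\Sigma$ let $\mathrm{Per}(x,\Gamma_n,\alpha)=\{g\in G:x(\gamma^{-1}g)=\alpha\ \forall\gamma\in\Gamma_n\}$, and set $$C_n=\{x\in X:\mathrm{Per}(x,\Gamma_n,\alpha)=\mathrm{Per}(\eta,\Gamma_n,\alpha)\ \forall\alpha\in\Sigma\},\qquad C_{n,i}=\{x\in C_n:x=i\text{ on }J(n)R\}.$$ For $n\ge 1$ let $\eta_n\in\Sigma^G$ be given by $\eta_n(\gamma u)=\eta(u)$ for $\gamma\in\Gamma_n$, $u\in D_nR$, and let $\mu_n=\frac1{|D_nR|}\sum_{u\in D_nR}\delta_{\sigma^{u^{-1}}\eta_n}$. For $i\in\{1,\dots,m\}$ let $\nu_i$ be a weak-* limit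 point of the sequence $(\mu_{i+sm-1})_{s\ge1}$ of probability measures on $\Sigma^G$. The $G$-odometer is $\overleftarrow G=\{(\Gamma_ng_n)_{n\ge1}\in\prod_{n\ge 1}\Gamma_n\backslash G:\Gamma_ng_{n+1}=\Gamma_ng_n\ \forall n\}$, with the action $\varphi^g((\Gamma_ng_n)_n)=(\Gamma_ng_ng^{-1})_n$. **Proposition 4.25.** There is a factor map $\pi:(X,\sigma,G)\to(\overleftarrow G,\varphi,G)$ such that the $n$-th coordinate of $\pi(x)$ is $\Gamma_ng$ if and only if $x\in\sigma^{g^{-1}}C_n$. The odometer has a unique invariant Borel probability measure $\mu$. For every $i\in\{1,\dots,m\}$ such limit points $\nu_i$ exist, and for each of them: $\nu_i$ is a $\sigma$-invariant probability measure on $X$, and $(X,\sigma,G,\nu_i)$ and $(\overleftarrow G,\varphi,G,\mu)$ are measure conjugate. More precisely, the set $$A_i=\bigcap_{g\in G}\bigcup_{k\ge1}\sigma^gZ_{i,k},\qquad Z_{i,k}=\bigcup_{v\in D_{i+km-1}R}\sigma^{v^{-1}}C_{i+km-1,i},$$ is a $\sigma$-invariant Borel subset of $X$ with $\nu_i(A_i)=1$,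 the map $\pi$ is injective on $A_i$, and $\pi|_{A_i}:A_i\to\pi(A_i)$ is a measure conjugacy, that is: $\pi(A_i)$ is a Borel invariant set of full $\mu$-measure, and $\pi|_{A_i}$ is an equivariant Borel isomorphism onto $\pi(A_i)$ with $\mu(B)=\nu_i((\pi|_{A_i})^{-1}(B))$ for all Borel $B\subseteq\pi(A_i)$. -/

import Mathlib

open Set Filter Topology MeasureTheory
open scoped Pointwise ENNReal

noncomputable section

namespace Toeplitz

/-! ### Dynamical systems, invariant measures, measure conjugacy -/

section Dynamics

variable {G X Y : Type*} [Group G]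

/-- A continuous action of the discrete group `G` on a compact metrizable space. -/
structure IsDynamicalSystem [TopologicalSpace X] (φ : G → X → X) : Prop where
  compact : CompactSpace X
  metrizable : TopologicalSpace.MetrizableSpace X
  one : ∀ x, φ 1 x = x
  mul : ∀ g h x, φ (g * h) x = φ g (φ h x)
  continuous : ∀ g, Continuous (φ g)

/-- An invariant Borel probability measure. -/
structure IsInvariantMeasure [MeasurableSpace X] (φ : G → X → X) (μ : Measure X) : Prop where
  prob : IsProbabilityMeasure μ
  invariant : ∀ (g : G) (A : Set X), MeasurableSet A → μ (φ g '' A) = μ A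

/-- A probability-measure-preserving dynamical system `(X, φ, G, μ)`. -/
structure IsPMPSystem [TopologicalSpace X] [MeasurableSpace X] (φ : G → X → X)
    (μ : Measure X) : Prop where
  system : IsDynamicalSystem φ
  invariant : IsInvariantMeasure φ μ

/-- A factor map between dynamical systems. -/
structure IsFactorMap [TopologicalSpace X] [TopologicalSpace Y] (φ : G → X → X)
    (ψ : G → Y → Y) (π : X → Y) : Prop where
  continuous : Continuous π
  surjective : Function.Surjective π
  equivariant : ∀ g x, π (φ g x) = ψ g (π x)

/-- The bijection `f : X' → Y'` between conull measurable invariant sets is a measure conjugacy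
between `(X, φ, G, μ)` and `(Y, ψ, G, ν)`. -/
structure IsMeasureConjugacy [MeasurableSpace X] [MeasurableSpace Y]
    (φ : G → X → X) (μ : Measure X) (ψ : G → Y → Y) (ν : Measure Y)
    (X' : Set X) (Y' : Set Y) (f : X' ≃ Y') : Prop where
  measurableSet_source : MeasurableSet X'
  measurableSet_target : MeasurableSet Y'
  conull_source : μ X'ᶜ = 0
  conull_target : ν Y'ᶜ = 0
  invariant_source : ∀ g, φ g '' X' ⊆ X'
  invariant_target : ∀ g, ψ g '' Y' ⊆ Y'
  measurable : Measurable f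
  measurable_symm : Measurable f.symm
  map_measure : ∀ A : Set Y, MeasurableSet A → A ⊆ Y' →
    ν A = μ (Subtype.val '' {x : X' | (f x : Y) ∈ A})
  equivariant : ∀ (g : G) (x : X') (hx : φ g x ∈ X'), (f ⟨φ g x, hx⟩ : Y) = ψ g (f x)

/-- Two measure-preserving systems are measure conjugate. -/
def MeasureConjugate [MeasurableSpace X] [MeasurableSpace Y]
    (φ : G → X → X) (μ : Measure X) (ψ : G → Y → Y) (ν : Measure Y) : Prop :=
  ∃ (X' : Set X) (Y' : Set Y) (f : X' ≃ Y'), IsMeasureConjugacy φ μ ψ ν X' Y' f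

/-- `ν` is a weak-* limit point of the sequence `M`, whose terms are probability measures from
some index on. -/
def IsWeakLimitPoint [TopologicalSpace X] [MeasurableSpace X] [OpensMeasurableSpace X]
    (M : ℕ → Measure X) (ν : ProbabilityMeasure X) : Prop :=
  ∃ P : ℕ → ProbabilityMeasure X,
    (∀ᶠ k in atTop, (P k : Measure X) = M k) ∧ MapClusterPt ν atTop P

end Dynamics

/-! ### Subshifts -/

section Shift

variable {G S : Type*} [Group G]

/-- The left shift: `(σ^g x)(h) = x (g⁻¹ h)`. -/
def shift (g : G) (x : G → S) : G → S := fun h => x (g⁻¹ * h)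

/-- `Per(x, Γ, α)`. -/
def Per (x : G → S) (Γ : Subgroup G) (α : S) : Set G :=
  {g | ∀ γ ∈ Γ, x (γ⁻¹ * g) = α}

theorem shift_mul (g h : G) (x : G → S) : shift (g * h) x = shift g (shift h x) := by
  funext k
  simp [shift, mul_assoc]

variable [TopologicalSpace S]

/-- The closure of the shift orbit of `y`. -/
def orbitClosure (y : G → S) : Set (G → S) := closure (range fun g : G => shift g y)

theorem continuous_shift (g : G) : Continuous (shift g : (G → S) → (G → S)) :=
  continuous_pi fun h => continuous_apply (g⁻¹ * h)

theorem shift_mem_orbitClosure (y : G → S) (g : G) {x : G → S} (hx : x ∈ orbitClosure y) :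
    shift g x ∈ orbitClosure y := by
  refine map_mem_closure (continuous_shift g) hx ?_
  rintro _ ⟨h, rfl⟩
  exact ⟨g * h, shift_mul g h y⟩

/-- The shift action on the subshift generated by `y`. -/
def shiftOn (y : G → S) (g : G) (x : orbitClosure y) : orbitClosure y :=
  ⟨shift g x.1, shift_mem_orbitClosure y g x.2⟩

end Shift

/-! ### The odometer of right cosets -/

section Odometer

variable {G : Type*} [Group G]

/-- The set `H \ G` of right cosets, with the discrete topology. -/
def RightCosets (H : Subgroup G) : Type _ := Quotient (QuotientGroup.rightRel H)

instance (H : Subgroup G) : TopologicalSpace (RightCosets H) := ⊥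

instance (H : Subgroup G) : DiscreteTopology (RightCosets H) := ⟨rfl⟩

/-- The right coset `H g`. -/
def RightCosets.mk (H : Subgroup G) (g : G) : RightCosets H :=
  Quotient.mk (QuotientGroup.rightRel H) g

theorem RightCosets.mk_eq_mk (H : Subgroup G) (a b : G) :
    RightCosets.mk H a = RightCosets.mk H b ↔ b * a⁻¹ ∈ H := by
  rw [← QuotientGroup.rightRel_apply]
  exact Quotient.eq

/-- Right translation `H h ↦ H h g⁻¹`. -/
def RightCosets.translate (H : Subgroup G) (g : G) : RightCosets H → RightCosets H :=
  Quotient.map (fun h => h * g⁻¹) fun a b hab => by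
    have h1 : b * a⁻¹ ∈ H := QuotientGroup.rightRel_apply.1 hab
    refine QuotientGroup.rightRel_apply.2 ?_
    simpa [mul_assoc] using h1

theorem RightCosets.translate_mk (H : Subgroup G) (g h : G) :
    RightCosets.translate H g (RightCosets.mk H h) = RightCosets.mk H (h * g⁻¹) := rfl

theorem RightCosets.exists_mk (H : Subgroup G) (z : RightCosets H) :
    ∃ g, z = RightCosets.mk H g := by
  obtain ⟨g, hg⟩ := Quotient.exists_rep z
  exact ⟨g, hg.symm⟩

/-- The odometer of the nested sequence `Γ 1 ⊇ Γ 2 ⊇ ⋯`: sequences of right cosets of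
`Γ 1, Γ 2, …` (coordinate `n` is a coset of `Γ (n + 1)`) that are compatible under the canonical
projections. -/
@[ext]
structure Odometer (Γ : ℕ → Subgroup G) where
  coord : ∀ n : ℕ, RightCosets (Γ (n + 1))
  compatible : ∀ (n : ℕ) (g : G), coord (n + 1) = RightCosets.mk (Γ (n + 2)) g →
    coord n = RightCosets.mk (Γ (n + 1)) g

/-- The subspace topology of the product topology. -/
instance (Γ : ℕ → Subgroup G) : TopologicalSpace (Odometer Γ) :=
  TopologicalSpace.induced Odometer.coord inferInstance

instance (Γ : ℕ → Subgroup G) : MeasurableSpace (Odometer Γ) := borel _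

instance (Γ : ℕ → Subgroup G) : BorelSpace (Odometer Γ) := ⟨rfl⟩

/-- The action `φ^g (Γ_n g_n)_n = (Γ_n g_n g⁻¹)_n` on the odometer. -/
def odometerAction (Γ : ℕ → Subgroup G) (g : G) (z : Odometer Γ) : Odometer Γ where
  coord n := RightCosets.translate (Γ (n + 1)) g (z.coord n)
  compatible := by
    intro n h hz
    obtain ⟨a, ha⟩ := RightCosets.exists_mk _ (z.coord (n + 1))
    have hn := z.compatible n (h * g) (by
      rw [ha] at hz ⊢
      rw [RightCosets.translate_mk, RightCosets.mk_eq_mk] at hz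
      rw [RightCosets.mk_eq_mk]
      simpa [mul_assoc] using hz)
    rw [hn, RightCosets.translate_mk, mul_inv_cancel_right]

end Odometer

/-! ### The lattices and the boxes in `ℤ^r` -/

section Lattice

variable {r : ℕ}

/-- The subgroup of `ℤ^r` generated by the vectors `p_j e_j`. -/
def lattice (p : Fin r → ℕ) : AddSubgroup (Fin r → ℤ) :=
  AddSubgroup.closure (range fun j => Pi.single j (p j : ℤ))

/-- The box `{x : -q₁ j ≤ x j < q₂ j for all j}`. -/
def box (q₁ q₂ : Fin r → ℕ) : Set (Fin r → ℤ) :=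
  {x | ∀ j, -(q₁ j : ℤ) ≤ x j ∧ x j < (q₂ j : ℤ)}

/-- The conditions on the periods `p^i_j` and on the boxes `D_i` given by `q₁ i`, `q₂ i`, for the
indices `i ≥ 1`; the values at `i = 0` play no role. -/
structure IsAdmissible (p q₁ q₂ : ℕ → Fin r → ℕ) : Prop where
  lt_succ : ∀ i, 1 ≤ i → ∀ j, p i j < p (i + 1) j
  dvd_succ : ∀ i, 1 ≤ i → ∀ j, p i j ∣ p (i + 1) j
  lt_period : ∀ i, 1 ≤ i → ∀ j, 2 * i + 1 < p i j
  index : ∀ i, 1 ≤ i →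
    1 / (1 - 1 / (2 : ℝ) ^ ((1 / 2 : ℝ) ^ (i + 1))) <
      ((lattice (p (i + 1))).relIndex (lattice (p i)) : ℝ)
  lt_left : ∀ i, 1 ≤ i → ∀ j, i < q₁ i j
  lt_right : ∀ i, 1 ≤ i → ∀ j, i < q₂ i j
  add_eq : ∀ i, 1 ≤ i → ∀ j, q₁ i j + q₂ i j = p i j
  tiling : ∀ i, 1 ≤ i → box (q₁ (i + 1)) (q₂ (i + 1)) =
    ⋃ γ ∈ box (q₁ (i + 1)) (q₂ (i + 1)) ∩ (lattice (p i) : Set (Fin r → ℤ)),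
      (fun x => γ + x) '' box (q₁ i) (q₂ i)

variable {G : Type*} [Group G] {N : Subgroup G}

/-- The subgroup of `N ≅ ℤ^r` corresponding to a subgroup of `ℤ^r`, as a subgroup of `G`. -/
def liftSubgroup (e : Multiplicative (Fin r → ℤ) ≃* N) (L : AddSubgroup (Fin r → ℤ)) :
    Subgroup G :=
  L.toSubgroup.map (N.subtype.comp e.toMonoidHom)

/-- The subset of `N ≅ ℤ^r` corresponding to a subset of `ℤ^r`, as a subset of `G`. -/
def liftSet (e : Multiplicative (Fin r → ℤ) ≃* N) (B : Set (Fin r → ℤ)) : Set G :=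
  (fun x => (e (Multiplicative.ofAdd x) : G)) '' B

end Lattice

/-! ### The Toeplitz array `η`

Throughout, `Γ n` and `D n` matter for `n ≥ 1` only. The alphabet is
`{1, …, m} ∪ {β}`, realized as `Fin (m + 1)` with `β = 0`. -/

section Construction

variable {G : Type*} [Group G]

/-- `J(0) = {1}` and `J(n) = D_n \ ⋃_{i < n} Γ_{i+1} J(i)` for `n ≥ 1`. -/
def J (Γ : ℕ → Subgroup G) (D : ℕ → Set G) : ℕ → Set G
  | 0 => {1}
  | n + 1 => D (n + 1) \ ⋃ i : Fin (n + 1), (Γ (i + 1) : Set G) * J Γ D i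

/-- For `n ≥ 1`, the symbol `α_n ∈ {1, …, m}` with `α_n ≡ n (mod m)`. -/
def symbol (m n : ℕ) : Fin (m + 1) := Fin.ofNat (m + 1) ((n - 1) % m + 1)

open Classical in
/-- The array `η`: it is `β` on `Γ_1 (R \ {1})`, it is `α_1` on `Γ_1`, and it is `α_{n+1}` on
`Γ_{n+1} J(n) R` for `n ≥ 1`. (These sets partition `G` in the setting of the theorem, so neither
the choice of the least `n` nor the default value matters.) -/
def eta (Γ : ℕ → Subgroup G) (D : ℕ → Set G) (R : Set G) (m : ℕ) : G → Fin (m + 1) := fun g =>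
  if g ∈ (Γ 1 : Set G) * (R \ {1}) then 0
  else if h : ∃ n, g ∈ (Γ (n + 1) : Set G) * J Γ D n * R then symbol m (Nat.find h + 1)
  else 0

open Classical in
/-- The periodic array `η_n`: `η_n (γ u) = η u` for `γ ∈ Γ_n` and `u ∈ D_n R`. (In the setting of
the theorem, `D_n R` meets each right coset of `Γ_n` in exactly one point.) -/
def etaPeriodic (Γ : ℕ → Subgroup G) (D : ℕ → Set G) (R : Set G) (m n : ℕ) :
    G → Fin (m + 1) := fun g =>
  if h : ∃ u ∈ D n * R, g * u⁻¹ ∈ Γ n then eta Γ D R m h.choose else 0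

/-- The measure `μ_n = |D_n R|⁻¹ ∑_{u ∈ D_n R} δ_{σ^{u⁻¹} η_n}`. -/
def periodicMeasure (Γ : ℕ → Subgroup G) (D : ℕ → Set G) (R : Set G) (m n : ℕ) :
    Measure (G → Fin (m + 1)) :=
  ((D n * R).ncard : ℝ≥0∞)⁻¹ •
    Measure.sum fun u : ↥(D n * R) => Measure.dirac (shift (u : G)⁻¹ (etaPeriodic Γ D R m n))

/-- The Toeplitz subshift generated by `η`. -/
abbrev subshift (Γ : ℕ → Subgroup G) (D : ℕ → Set G) (R : Set G) (m : ℕ) :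
    Set (G → Fin (m + 1)) :=
  orbitClosure (eta Γ D R m)

/-- The set `C_n` of points of the subshift with the same `Γ_n`-periodic part as `η`. -/
def C (Γ : ℕ → Subgroup G) (D : ℕ → Set G) (R : Set G) (m n : ℕ) : Set (G → Fin (m + 1)) :=
  {x | x ∈ subshift Γ D R m ∧ ∀ α, Per x (Γ n) α = Per (eta Γ D R m) (Γ n) α}

/-- The set `C_{n,i}` of points of `C_n` that are equal to `i` on `J(n) R`. -/
def CSymbol (Γ : ℕ → Subgroup G) (D : ℕ → Set G) (R : Set G) (m n : ℕ) (i : Fin (m + 1)) :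
    Set (G → Fin (m + 1)) :=
  {x | x ∈ C Γ D R m n ∧ ∀ g ∈ J Γ D n * R, x g = i}

/-- `Z_{i,k} = ⋃_{v ∈ D_n R} σ^{v⁻¹} C_{n,i}` with `n = i + k m - 1`. -/
def Z (Γ : ℕ → Subgroup G) (D : ℕ → Set G) (R : Set G) (m : ℕ) (i : Fin (m + 1)) (k : ℕ) :
    Set (G → Fin (m + 1)) :=
  ⋃ v ∈ D (i + k * m - 1) * R, shift v⁻¹ '' CSymbol Γ D R m (i + k * m - 1) i

/-- `A_i = ⋂_{g ∈ G} ⋃_{k ≥ 1} σ^g Z_{i,k}`, as a subset of the subshift. -/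
def A (Γ : ℕ → Subgroup G) (D : ℕ → Set G) (R : Set G) (m : ℕ) (i : Fin (m + 1)) :
    Set (subshift Γ D R m) :=
  Subtype.val ⁻¹' ⋂ g : G, ⋃ k : ℕ, ⋃ _ : 1 ≤ k, shift g '' Z Γ D R m i k

end Construction

end Toeplitz

end

namespace Toeplitz

/-! The sets `Γ (n + 1) * J n` partition `N`; call `n` the level of a point. On level `n` the array
`η` carries the symbol `α_{n+1}`, apart from the `β`s on level `0`. Consecutive symbols differ, and
the `β`s mark the coset `N` among its translates. Hence the pattern of `η` on the levels below `n`
has no period outside `Γ n` (`mem_of_eqOn_shift`), and every point of the subshift has, for each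
`n`, a phase that is well defined modulo `Γ n` (`exists_phase`). The phases form a point of the
odometer. This is `π`, which is continuous because `C n` is closed (`mem_C_iff`) and surjective by
compactness.

The periodic array `η_n` fills everything left open by the levels below `n` with `α_{n+1}`, and this
symbol is `i` when `n = i + s m - 1`. The index condition makes level `j` so sparse that the tiles
of size `k` meeting some level `k ≤ j < n` occupy a proportion at most `2^{-k}` of `D n * R`
(`ncard_notMem_symbolSet_le`). The Følner property of the boxes shows that windows of `η_n` are
mostly windows of `η` (`ncard_notMem_windowSet_le`). In the limit `ν_i` is invariant, lives on the
subshift, and gives mass at least `1 - 2^{-k}` to the points that, around the identity, show the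
`k`-th pattern of `η` with all holes filled by `i`. So `ν_i(A_i) = 1` (`measure_compl_A`).

On `A_i` the phases determine the point: each coordinate is either read off `η` or lies in a hole,
where it equals `i` (`value_of_mem_A`). Thus `π` is injective on `A_i`, and Lusin–Souslin makes it a
Borel isomorphism onto its image. Since the odometer is uniquely ergodic, `π` sends every `ν_i` to
the same `μ`. -/

/-- The combinatorial properties of the subgroups `Γ n`, of their fundamental domains `D n` in `N`
and of the set `R` of representatives of `G / N` on which the construction of `η` relies. -/
structure TilingData {G : Type*} [Group G] (N : Subgroup G) (Γ : ℕ → Subgroup G) (D : ℕ → Set G)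
    (R : Set G) : Prop where
  normal : N.Normal
  comm : ∀ x ∈ N, ∀ y ∈ N, x * y = y * x
  one_mem_R : (1 : G) ∈ R
  finite_R : R.Finite
  exists_rep : ∀ g, ∃ x ∈ N, ∃ ρ ∈ R, g = x * ρ
  rep_unique : ∀ ρ ∈ R, ∀ ρ' ∈ R, ρ * ρ'⁻¹ ∈ N → ρ = ρ'
  le : ∀ n, 1 ≤ n → Γ n ≤ N
  succ_le : ∀ n, 1 ≤ n → Γ (n + 1) ≤ Γ n
  subset : ∀ n, 1 ≤ n → D n ⊆ N
  finite : ∀ n, 1 ≤ n → (D n).Finite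
  one_mem_D : ∀ n, 1 ≤ n → (1 : G) ∈ D n
  exists_mul : ∀ n, 1 ≤ n → ∀ x ∈ N, ∃ γ ∈ Γ n, ∃ d ∈ D n, x = γ * d
  unique : ∀ n, 1 ≤ n → ∀ d ∈ D n, ∀ d' ∈ D n, d * d'⁻¹ ∈ Γ n → d = d'
  tile_exists : ∀ n, 1 ≤ n → ∀ x ∈ D (n + 1), ∃ γ ∈ Γ n, γ ∈ D (n + 1) ∧ ∃ d ∈ D n, x = γ * d
  tile_mem : ∀ n, 1 ≤ n → ∀ γ ∈ Γ n, γ ∈ D (n + 1) → ∀ d ∈ D n, γ * d ∈ D (n + 1)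
  exhaust : ∀ x ∈ N, ∃ n, 1 ≤ n ∧ x ∈ D n
  nontrivial : ∃ d ∈ D 1, d ≠ 1
  growth : ∀ n, 1 ≤ n → 2 ^ (n + 1) ≤ (D (n + 1) ∩ Γ n).ncard
  folner : ∀ x ∈ N, ∃ c : ℕ, ∀ n, 1 ≤ n → n * {d ∈ D n | x * d ∉ D n}.ncard ≤ c * (D n).ncard

/-! ### Levels, the values of `η`, and the phases of points of the subshift -/

section Combinatorics

variable {G : Type*} [Group G] {N : Subgroup G} {Γ : ℕ → Subgroup G} {D : ℕ → Set G} {R : Set G}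
  {m : ℕ}

/-- The part of `N` on which `η` is `Γ n`-periodic. -/
def periodicPart (Γ : ℕ → Subgroup G) (D : ℕ → Set G) (n : ℕ) : Set G :=
  ⋃ i : Fin n, (Γ (i + 1) : Set G) * J Γ D i

theorem mem_periodicPart {n : ℕ} {x : G} :
    x ∈ periodicPart Γ D n ↔ ∃ i < n, ∃ γ ∈ Γ (i + 1), ∃ y ∈ J Γ D i, γ * y = x := by
  simp only [periodicPart, mem_iUnion, Set.mem_mul, SetLike.mem_coe]
  constructor
  · rintro ⟨i, h⟩
    exact ⟨i, i.2, h⟩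
  · rintro ⟨i, hi, h⟩
    exact ⟨⟨i, hi⟩, h⟩

theorem J_succ (n : ℕ) : J Γ D (n + 1) = D (n + 1) \ periodicPart Γ D (n + 1) := by
  rw [J, periodicPart]

theorem mem_J {n : ℕ} (hn : 1 ≤ n) {x : G} :
    x ∈ J Γ D n ↔ x ∈ D n ∧ x ∉ periodicPart Γ D n := by
  obtain ⟨k, rfl⟩ : ∃ k, n = k + 1 := ⟨n - 1, by omega⟩
  rw [J_succ]; rfl

theorem periodicPart_mono {k n : ℕ} (h : k ≤ n) : periodicPart Γ D k ⊆ periodicPart Γ D n := by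
  intro x hx
  rw [mem_periodicPart] at hx ⊢
  obtain ⟨i, hi, h'⟩ := hx
  exact ⟨i, by omega, h'⟩

theorem mem_J_zero {x : G} : x ∈ J Γ D 0 ↔ x = 1 := by
  simp [J]

theorem symbol_ne_zero (hm : 2 ≤ m) (n : ℕ) : symbol m n ≠ 0 := by
  have h1 : (n - 1) % m < m := Nat.mod_lt _ (by omega)
  intro h0
  have := congrArg Fin.val h0
  simp only [symbol, Fin.ofNat, Fin.val_zero] at this
  rw [Nat.mod_eq_of_lt (by omega)] at this
  omega

theorem symbol_val (hm : 2 ≤ m) (n : ℕ) : (symbol m n : ℕ) = (n - 1) % m + 1 := by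
  have h1 : (n - 1) % m < m := Nat.mod_lt _ (by omega)
  simp only [symbol, Fin.ofNat]
  exact Nat.mod_eq_of_lt (by omega)

/-- Equality would force `m ∣ 1`. This is what tells adjacent levels apart and prevents `η` from
having extra periods. -/
theorem symbol_succ_ne (hm : 2 ≤ m) (n : ℕ) : symbol m (n + 2) ≠ symbol m (n + 1) := by
  intro h0
  have := congrArg Fin.val h0
  rw [symbol_val hm, symbol_val hm] at this
  simp only [Nat.add_sub_cancel, show n + 2 - 1 = n + 1 by omega, Nat.add_right_cancel_iff] at this
  have h2 : n + 1 ≡ n + 0 [MOD m] := this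
  have h3 := Nat.ModEq.add_left_cancel' n h2
  have h4 := Nat.le_of_dvd one_pos ((Nat.modEq_zero_iff_dvd).1 h3)
  omega

/-- The arrays that agree with `η` on the `Γ n`-periodic part and have no further zeros. -/
def skeleton (Γ : ℕ → Subgroup G) (D : ℕ → Set G) (R : Set G) (m n : ℕ) :
    Set (G → Fin (m + 1)) :=
  {x | EqOn x (eta Γ D R m) (periodicPart Γ D n * R) ∧ ∀ g ∉ (Γ 1 : Set G) * (R \ {1}), x g ≠ 0}

theorem skeleton_anti {k n : ℕ} (hkn : k ≤ n) : skeleton Γ D R m n ⊆ skeleton Γ D R m k :=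
  fun _ hx => ⟨hx.1.mono (mul_subset_mul_right (periodicPart_mono hkn)), hx.2⟩

theorem isClosed_setOf_eqOn {I : Type*} (S : Set I) (y : I → Fin (m + 1)) :
    IsClosed {x | EqOn x y S} := by
  have : {x : I → Fin (m + 1) | EqOn x y S} = ⋂ g ∈ S, {x | x g = y g} := by
    ext x; simp [EqOn]
  rw [this]
  exact isClosed_biInter fun g _ => isClosed_eq (continuous_apply g) continuous_const

theorem isClosed_skeleton (n : ℕ) : IsClosed (skeleton Γ D R m n) := by
  refine (isClosed_setOf_eqOn _ _).inter ?_
  have : {x : G → Fin (m + 1) | ∀ g ∉ (Γ 1 : Set G) * (R \ {1}), x g ≠ 0} =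
      ⋂ g ∈ ((Γ 1 : Set G) * (R \ {1}))ᶜ, (fun x => x g) ⁻¹' {0}ᶜ := by
    ext x; simp
  change IsClosed {x : G → Fin (m + 1) | ∀ g ∉ (Γ 1 : Set G) * (R \ {1}), x g ≠ 0}
  rw [this]
  refine isClosed_biInter fun g _ => ?_
  exact (isClosed_discrete _).preimage (continuous_apply g)

theorem shift_one (x : G → Fin (m + 1)) : shift 1 x = x := by
  funext k; simp [shift]

theorem shift_inv_shift (g : G) (x : G → Fin (m + 1)) : shift g⁻¹ (shift g x) = x := by
  rw [← shift_mul, inv_mul_cancel, shift_one]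

theorem shift_shift_inv (g : G) (x : G → Fin (m + 1)) : shift g (shift g⁻¹ x) = x := by
  rw [← shift_mul, mul_inv_cancel, shift_one]

theorem mem_shift_inv_image {g : G} {S : Set (G → Fin (m + 1))} {x : G → Fin (m + 1)} :
    x ∈ shift g⁻¹ '' S ↔ shift g x ∈ S := by
  constructor
  · rintro ⟨y, hy, rfl⟩
    rwa [shift_shift_inv]
  · exact fun hx => ⟨_, hx, shift_inv_shift g x⟩

theorem per_shift {n : ℕ} {γ : G} (hγ : γ ∈ Γ n) (x : G → Fin (m + 1)) (α : Fin (m + 1)) :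
    Per (shift γ x) (Γ n) α = Per x (Γ n) α := by
  ext g
  constructor
  · intro hg δ hδ
    have := hg (δ * γ⁻¹) (mul_mem hδ (inv_mem hγ))
    simpa [shift, mul_assoc] using this
  · intro hg δ hδ
    have := hg (δ * γ) (mul_mem hδ hγ)
    simpa [shift, mul_assoc] using this

theorem J_subset_periodicPart {k n : ℕ} (hkn : k < n) : J Γ D k ⊆ periodicPart Γ D n :=
  fun y hy => mem_periodicPart.2 ⟨k, hkn, 1, one_mem _, y, hy, one_mul y⟩

namespace TilingData

variable (h : TilingData N Γ D R)
include h

theorem anti {k n : ℕ} (hk : 1 ≤ k) (hkn : k ≤ n) : Γ n ≤ Γ k := by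
  induction n, hkn using Nat.le_induction with
  | base => exact le_rfl
  | succ n hkn ih => exact (h.succ_le n (by omega)).trans ih

theorem J_subset {n : ℕ} : J Γ D n ⊆ N := by
  rcases n with _ | n
  · simp [J, N.one_mem]
  · exact fun x hx => h.subset _ (by omega) ((mem_J (by omega)).1 hx).1

theorem periodicPart_subset {n : ℕ} : periodicPart Γ D n ⊆ N := by
  intro x hx
  obtain ⟨i, -, γ, hγ, y, hy, rfl⟩ := mem_periodicPart.1 hx
  exact N.mul_mem (h.le _ (by omega) hγ) (h.J_subset hy)

theorem mul_mem_periodicPart {n : ℕ} (hn : 1 ≤ n) {γ x : G} (hγ : γ ∈ Γ n)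
    (hx : x ∈ periodicPart Γ D n) : γ * x ∈ periodicPart Γ D n := by
  obtain ⟨i, hi, δ, hδ, y, hy, rfl⟩ := mem_periodicPart.1 hx
  exact mem_periodicPart.2 ⟨i, hi, γ * δ, mul_mem (h.anti (by omega) (by omega) hγ) hδ, y, hy,
    by group⟩

theorem mul_mem_periodicPart_iff {n : ℕ} (hn : 1 ≤ n) {γ x : G} (hγ : γ ∈ Γ n) :
    γ * x ∈ periodicPart Γ D n ↔ x ∈ periodicPart Γ D n := by
  refine ⟨fun hx => ?_, h.mul_mem_periodicPart hn hγ⟩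
  simpa using h.mul_mem_periodicPart hn (inv_mem hγ) hx

/-- The periodic part is invariant under `Γ n`, so reducing a point of its complement into `D n`
lands in `J n`. -/
theorem exists_of_notMem_periodicPart {n : ℕ} (hn : 1 ≤ n) {x : G} (hx : x ∈ N)
    (hxU : x ∉ periodicPart Γ D n) : ∃ γ ∈ Γ n, ∃ y ∈ J Γ D n, x = γ * y := by
  obtain ⟨γ, hγ, d, hd, rfl⟩ := h.exists_mul n hn x hx
  exact ⟨γ, hγ, d, (mem_J hn).2 ⟨hd, fun hd' => hxU (h.mul_mem_periodicPart hn hγ hd')⟩, rfl⟩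

/-- Elements of `D n` that differ by left multiplication by elements of `Γ n` agree. -/
theorem unique' {n : ℕ} (hn : 1 ≤ n) {γ γ' d d' : G} (hγ : γ ∈ Γ n) (hγ' : γ' ∈ Γ n)
    (hd : d ∈ D n) (hd' : d' ∈ D n) (he : γ * d = γ' * d') : γ = γ' ∧ d = d' := by
  have : d = d' := by
    refine h.unique n hn d hd d' hd' ?_
    have : d * d'⁻¹ = γ⁻¹ * γ' := by
      rw [eq_inv_mul_iff_mul_eq, ← mul_assoc, he, mul_inv_cancel_right]
    rw [this]
    exact mul_mem (inv_mem hγ) hγ'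
  subst this
  exact ⟨mul_right_cancel he, rfl⟩

/-- The boxes exhaust `N`, and a point of `D n` missed by all levels below `n` is in `J n` by
definition. Together with `level_unique` this partitions `N` into levels. -/
theorem exists_level {x : G} (hx : x ∈ N) : ∃ n, ∃ γ ∈ Γ (n + 1), ∃ y ∈ J Γ D n, γ * y = x := by
  obtain ⟨n, hn, hxn⟩ := h.exhaust x hx
  by_cases hU : x ∈ periodicPart Γ D n
  · obtain ⟨i, -, h'⟩ := mem_periodicPart.1 hU
    exact ⟨i, h'⟩
  · exact ⟨n, 1, one_mem _, x, (mem_J hn).2 ⟨hxn, hU⟩, one_mul _⟩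

/-- If `i < j`, then `Γ (j + 1) ≤ Γ j` preserves the periodic part of order `j`, which would then
contain a point of `J j`. -/
theorem level_le {i j : ℕ} {γ γ' y y' : G} (hγ : γ ∈ Γ (i + 1)) (hy : y ∈ J Γ D i)
    (hγ' : γ' ∈ Γ (j + 1)) (hy' : y' ∈ J Γ D j) (he : γ * y = γ' * y') : j ≤ i := by
  by_contra hlt
  have : y' ∈ periodicPart Γ D j := by
    rw [show y' = γ'⁻¹ * (γ * y) by rw [he]; group]
    exact h.mul_mem_periodicPart (by omega) (inv_mem (h.anti (by omega) (by omega) hγ'))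
      (mem_periodicPart.2 ⟨i, by omega, γ, hγ, y, hy, rfl⟩)
  exact ((mem_J (by omega)).1 hy').2 this

theorem level_unique {i j : ℕ} {γ γ' y y' : G} (hγ : γ ∈ Γ (i + 1)) (hy : y ∈ J Γ D i)
    (hγ' : γ' ∈ Γ (j + 1)) (hy' : y' ∈ J Γ D j) (he : γ * y = γ' * y') : i = j :=
  le_antisymm (h.level_le hγ' hy' hγ hy he.symm) (h.level_le hγ hy hγ' hy' he)

/-- `D n` is a union of translates of `D k` for `k ≤ n`. -/
theorem tile_mem_of_le {k n : ℕ} (hk : 1 ≤ k) (hkn : k ≤ n) {γ d : G} (hγ : γ ∈ Γ k)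
    (hγn : γ ∈ D n) (hd : d ∈ D k) : γ * d ∈ D n := by
  induction n, hkn using Nat.le_induction generalizing γ with
  | base =>
    have := h.unique k hk γ hγn 1 (h.one_mem_D k hk) (by simpa using hγ)
    simpa [this] using hd
  | succ n hkn ih =>
    obtain ⟨δ, hδ, hδn, d₁, hd₁, rfl⟩ := h.tile_exists n (by omega) γ hγn
    have hd₁k : d₁ ∈ Γ k := by
      have := mul_mem (inv_mem (h.anti hk hkn hδ)) hγ
      simpa using this
    rw [mul_assoc]
    exact h.tile_mem n (by omega) δ hδ hδn _ (ih hd₁k hd₁)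

theorem tile_exists_of_le {k n : ℕ} (hk : 1 ≤ k) (hkn : k ≤ n) {x : G} (hx : x ∈ D n) :
    ∃ γ ∈ Γ k, γ ∈ D n ∧ ∃ d ∈ D k, x = γ * d := by
  induction n, hkn using Nat.le_induction generalizing x with
  | base => exact ⟨1, one_mem _, h.one_mem_D k hk, x, hx, (one_mul x).symm⟩
  | succ n hkn ih =>
    obtain ⟨δ, hδ, hδn, d₁, hd₁, rfl⟩ := h.tile_exists n (by omega) x hx
    obtain ⟨ε, hε, hεn, d, hd, rfl⟩ := ih hd₁
    exact ⟨δ * ε, mul_mem (h.anti hk hkn hδ) hε, h.tile_mem n (by omega) δ hδ hδn ε hεn, d, hd,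
      (mul_assoc _ _ _).symm⟩

theorem D_mono {k n : ℕ} (hk : 1 ≤ k) (hkn : k ≤ n) : D k ⊆ D n := fun d hd => by
  simpa using h.tile_mem_of_le hk hkn (one_mem _) (h.one_mem_D n (by omega)) hd

/-- Translates of `J n` by nontrivial elements of `Γ n` in `D (n + 1)` are in `J (n + 1)`. -/
theorem mul_mem_J_succ {n : ℕ} (hn : 1 ≤ n) {γ y : G} (hγ : γ ∈ Γ n) (hγD : γ ∈ D (n + 1))
    (hγ1 : γ ≠ 1) (hy : y ∈ J Γ D n) : γ * y ∈ J Γ D (n + 1) := by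
  have hy' := (mem_J hn).1 hy
  refine (mem_J (by omega)).2 ⟨h.tile_mem n hn γ hγ hγD y hy'.1, fun hU => ?_⟩
  obtain ⟨i, hi, δ, hδ, z, hz, he⟩ := mem_periodicPart.1 hU
  rcases Nat.lt_succ_iff_lt_or_eq.1 hi with hi | rfl
  · have : γ * y ∈ periodicPart Γ D n := mem_periodicPart.2 ⟨i, hi, δ, hδ, z, hz, he⟩
    exact hy'.2 ((h.mul_mem_periodicPart_iff hn hγ).1 this)
  · have := (h.unique' hn (h.succ_le i hn hδ) hγ ((mem_J hn).1 hz).1 hy'.1 he).1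
    subst this
    exact hγ1 (h.unique (i + 1) (by omega) δ hγD 1 (h.one_mem_D _ (by omega)) (by simpa using hδ))

theorem exists_ne_one {n : ℕ} (hn : 1 ≤ n) : ∃ γ ∈ Γ n, γ ∈ D (n + 1) ∧ γ ≠ 1 := by
  by_contra! hcon
  have : D (n + 1) ∩ Γ n ⊆ {1} := fun γ hγ => hcon γ hγ.2 hγ.1
  have h1 := Set.ncard_le_ncard this
  have h2 := h.growth n hn
  have h3 : 2 ^ 2 ≤ 2 ^ (n + 1) := Nat.pow_le_pow_right (by norm_num) (by omega)
  simp at h1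
  omega

/-- Any point of `D 1` other than `1` starts the induction; nontrivial translates carry `J n` into
`J (n + 1)`. -/
theorem J_nonempty (n : ℕ) : (J Γ D n).Nonempty := by
  induction n with
  | zero => exact ⟨1, by simp [J]⟩
  | succ n ih =>
    rcases Nat.eq_zero_or_pos n with rfl | hn
    · obtain ⟨d, hd, hd1⟩ := h.nontrivial
      refine ⟨d, (mem_J le_rfl).2 ⟨hd, fun hU => hd1 ?_⟩⟩
      obtain ⟨i, hi, γ, hγ, y, hy, rfl⟩ := mem_periodicPart.1 hU
      obtain rfl : i = 0 := by omega
      obtain rfl := mem_J_zero.1 hy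
      exact h.unique 1 le_rfl _ hd 1 (h.one_mem_D 1 le_rfl) (by simpa using hγ)
    · obtain ⟨y, hy⟩ := ih
      obtain ⟨γ, hγ, hγD, hγ1⟩ := h.exists_ne_one hn
      exact ⟨γ * y, h.mul_mem_J_succ hn hγ hγD hγ1 hy⟩

theorem rep_unique' {x y ρ ρ' : G} (hx : x ∈ N) (hy : y ∈ N) (hρ : ρ ∈ R) (hρ' : ρ' ∈ R)
    (he : x * ρ = y * ρ') : x = y ∧ ρ = ρ' := by
  have : ρ = ρ' := by
    refine h.rep_unique ρ hρ ρ' hρ' ?_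
    have : ρ * ρ'⁻¹ = x⁻¹ * y := by
      rw [eq_inv_mul_iff_mul_eq, ← mul_assoc, he, mul_inv_cancel_right]
    rw [this]
    exact mul_mem (inv_mem hx) hy
  subst this
  exact ⟨mul_right_cancel he, rfl⟩

/-! ### The values of `η` -/

theorem mem_zeroSet {x ρ : G} (hx : x ∈ N) (hρ : ρ ∈ R) :
    x * ρ ∈ (Γ 1 : Set G) * (R \ {1}) ↔ x ∈ Γ 1 ∧ ρ ≠ 1 := by
  constructor
  · rintro ⟨γ, hγ, ρ', ⟨hρ', hne⟩, he⟩
    obtain ⟨rfl, rfl⟩ := h.rep_unique' (h.le 1 le_rfl hγ) hx hρ' hρ he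
    exact ⟨hγ, hne⟩
  · rintro ⟨hx', hne⟩
    exact ⟨x, hx', ρ, ⟨hρ, hne⟩, rfl⟩

/-- The condition `hn` excludes exactly the positions of `β`: level `0` with `ρ ≠ 1`. Elsewhere the
minimum taken in `eta` is the level, by uniqueness. -/
theorem eta_of_level {n : ℕ} {γ y ρ : G} (hγ : γ ∈ Γ (n + 1)) (hy : y ∈ J Γ D n) (hρ : ρ ∈ R)
    (hn : 1 ≤ n ∨ ρ = 1) : eta Γ D R m (γ * y * ρ) = symbol m (n + 1) := by
  classical
  have hN : γ * y ∈ N := mul_mem (h.le _ (by omega) hγ) (h.J_subset hy)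
  have h0 : γ * y * ρ ∉ (Γ 1 : Set G) * (R \ {1}) := by
    rw [h.mem_zeroSet hN hρ]
    rintro ⟨h1, h2⟩
    have h3 : 1 ≤ n := hn.resolve_right h2
    have := h.level_le (i := 0) (j := n) (γ := γ * y) (y := 1) (by simpa using h1)
      (by simp [J]) hγ hy (by simp)
    omega
  have hex : ∃ k, γ * y * ρ ∈ (Γ (k + 1) : Set G) * J Γ D k * R :=
    ⟨n, γ * y, ⟨γ, hγ, y, hy, rfl⟩, ρ, hρ, rfl⟩
  rw [eta, if_neg h0, dif_pos hex]
  congr 2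
  obtain ⟨x, ⟨δ, hδ, z, hz, rfl⟩, ρ', hρ', he⟩ := Nat.find_spec hex
  have := (h.rep_unique' (mul_mem (h.le _ (by omega) hδ) (h.J_subset hz)) hN hρ' hρ he).1
  exact h.level_unique hδ hz hγ hy this

theorem eta_of_zero {x ρ : G} (hx : x ∈ Γ 1) (hρ : ρ ∈ R) (h1 : ρ ≠ 1) :
    eta Γ D R m (x * ρ) = 0 := by
  rw [eta, if_pos ((h.mem_zeroSet (h.le 1 le_rfl hx) hρ).2 ⟨hx, h1⟩)]

theorem eta_ne_zero (hm : 2 ≤ m) {x ρ : G} (hx : x ∈ N) (hρ : ρ ∈ R) (h0 : ¬(x ∈ Γ 1 ∧ ρ ≠ 1)) :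
    eta Γ D R m (x * ρ) ≠ 0 := by
  obtain ⟨n, γ, hγ, y, hy, rfl⟩ := h.exists_level hx
  rw [h.eta_of_level hγ hy hρ]
  · exact symbol_ne_zero hm _
  · by_contra! hcon
    obtain ⟨hn, hρ1⟩ := hcon
    obtain rfl : n = 0 := by omega
    obtain rfl := mem_J_zero.1 hy
    exact h0 ⟨by simpa using hγ, hρ1⟩

/-- `η` is `Γ n`-periodic on `periodicPart n * R`. -/
theorem eta_mul {n : ℕ} (hn : 1 ≤ n) {γ x ρ : G} (hγ : γ ∈ Γ n)
    (hx : x ∈ periodicPart Γ D n) (hρ : ρ ∈ R) :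
    eta Γ D R m (γ * (x * ρ)) = eta Γ D R m (x * ρ) := by
  obtain ⟨i, hi, δ, hδ, y, hy, rfl⟩ := mem_periodicPart.1 hx
  have hγδ : γ * δ ∈ Γ (i + 1) := mul_mem (h.anti (by omega) (by omega) hγ) hδ
  have he : γ * (δ * y * ρ) = γ * δ * y * ρ := by group
  rw [he]
  by_cases hc : 1 ≤ i ∨ ρ = 1
  · rw [h.eta_of_level hγδ hy hρ hc, h.eta_of_level hδ hy hρ hc]
  · push Not at hc
    obtain rfl : i = 0 := by omega
    obtain rfl := mem_J_zero.1 hy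
    rw [h.eta_of_zero (by simpa using hγδ) hρ hc.2, h.eta_of_zero (by simpa using hδ) hρ hc.2]

theorem eta_J {n : ℕ} (hn : 1 ≤ n) {y ρ : G} (hy : y ∈ J Γ D n) (hρ : ρ ∈ R) :
    eta Γ D R m (y * ρ) = symbol m (n + 1) := by
  simpa using h.eta_of_level (m := m) (one_mem (Γ (n + 1))) hy hρ (Or.inl hn)

/-! ### The phases of the points of the subshift -/

theorem eta_mem_skeleton (hm : 2 ≤ m) (n : ℕ) : eta Γ D R m ∈ skeleton Γ D R m n := by
  refine ⟨fun _ _ => rfl, fun g hg => ?_⟩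
  obtain ⟨x, hx, ρ, hρ, rfl⟩ := h.exists_rep g
  exact h.eta_ne_zero hm hx hρ (fun hc => hg ((h.mem_zeroSet hx hρ).2 hc))

theorem eqOn_shift {n : ℕ} (hn : 1 ≤ n) {γ : G} (hγ : γ ∈ Γ n) {x : G → Fin (m + 1)}
    (hx : EqOn x (eta Γ D R m) (periodicPart Γ D n * R)) :
    EqOn (shift γ x) (eta Γ D R m) (periodicPart Γ D n * R) := by
  rintro _ ⟨u, hu, ρ, hρ, rfl⟩
  have h1 : γ⁻¹ * u ∈ periodicPart Γ D n := h.mul_mem_periodicPart hn (inv_mem hγ) hu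
  have h2 := hx ⟨_, h1, ρ, hρ, rfl⟩
  have h3 := h.eta_mul (m := m) hn (inv_mem hγ) hu hρ
  simp only [shift] at h2 ⊢
  rw [← h3, ← mul_assoc, h2]

theorem shift_mem_skeleton {n : ℕ} (hn : 1 ≤ n) {γ : G} (hγ : γ ∈ Γ n) {x : G → Fin (m + 1)}
    (hx : x ∈ skeleton Γ D R m n) : shift γ x ∈ skeleton Γ D R m n := by
  refine ⟨h.eqOn_shift hn hγ hx.1, fun g hg => hx.2 _ fun hc => hg ?_⟩
  obtain ⟨δ, hδ, ρ, hρ, he⟩ := hc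
  refine ⟨γ * δ, mul_mem (h.anti le_rfl hn hγ) hδ, ρ, hρ, ?_⟩
  simp only at he ⊢
  rw [mul_assoc, he, mul_inv_cancel_left]

theorem finite_D_mul_R {n : ℕ} (hn : 1 ≤ n) : (D n * R).Finite := (h.finite n hn).mul h.finite_R

theorem exists_mul_D_mul_R {n : ℕ} (hn : 1 ≤ n) (g : G) :
    ∃ γ ∈ Γ n, ∃ u ∈ D n * R, g = γ * u := by
  obtain ⟨x, hx, ρ, hρ, rfl⟩ := h.exists_rep g
  obtain ⟨γ, hγ, d, hd, rfl⟩ := h.exists_mul n hn x hx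
  exact ⟨γ, hγ, d * ρ, ⟨d, hd, ρ, hρ, rfl⟩, mul_assoc _ _ _⟩

theorem D_mul_R_unique {n : ℕ} (hn : 1 ≤ n) {u v : G} (hu : u ∈ D n * R) (hv : v ∈ D n * R)
    (huv : u * v⁻¹ ∈ Γ n) : u = v := by
  obtain ⟨d, hd, ρ, hρ, rfl⟩ := hu
  obtain ⟨d', hd', ρ', hρ', rfl⟩ := hv
  simp only at huv ⊢
  have hγ : d * ρ = (d * ρ * (d' * ρ')⁻¹ * d') * ρ' := by group
  obtain ⟨h1, rfl⟩ := h.rep_unique' (h.subset n hn hd)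
    (mul_mem (h.le n hn huv) (h.subset n hn hd')) hρ hρ' hγ
  rw [h.unique n hn d hd d' hd' (by simpa [mul_assoc] using huv)]

/-- The subshift is covered by finitely many translates of `skeleton n`. -/
theorem exists_shift_mem_skeleton (hm : 2 ≤ m) {n : ℕ} (hn : 1 ≤ n) {x : G → Fin (m + 1)}
    (hx : x ∈ subshift Γ D R m) : ∃ c, shift c x ∈ skeleton Γ D R m n := by
  have hcl : IsClosed (⋃ u ∈ D n * R, shift u ⁻¹' skeleton Γ D R m n) :=
    (h.finite_D_mul_R hn).isClosed_biUnion fun u _ =>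
      (isClosed_skeleton n).preimage (continuous_shift u)
  have hsub : (range fun g : G => shift g (eta Γ D R m)) ⊆
      ⋃ u ∈ D n * R, shift u ⁻¹' skeleton Γ D R m n := by
    rintro _ ⟨g, rfl⟩
    obtain ⟨γ, hγ, u, hu, he⟩ := h.exists_mul_D_mul_R hn g⁻¹
    refine mem_biUnion hu ?_
    have : u * g = γ⁻¹ := by
      rw [show u = γ⁻¹ * g⁻¹ by rw [he]; group]; group
    rw [mem_preimage, ← shift_mul, this]
    exact h.shift_mem_skeleton hn (inv_mem hγ) (h.eta_mem_skeleton hm n)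
  have := closure_minimal hsub hcl hx
  simp only [mem_iUnion] at this
  obtain ⟨u, -, hu⟩ := this
  exact ⟨u, hu⟩

/-- Left translation by `g⁻¹` permutes the cosets of `N`. By comparing zeros it sends cosets other
than `N` to cosets other than `N`, so by finiteness it fixes `N`. -/
theorem mem_of_eqOn_shift_zeros {y : G → Fin (m + 1)} (hy : y ∈ skeleton Γ D R m 2)
    {g : G} (hg : EqOn (shift g y) (eta Γ D R m) (periodicPart Γ D 1 * R)) : g ∈ N := by
  have h1U : (1 : G) ∈ periodicPart Γ D 1 :=
    mem_periodicPart.2 ⟨0, one_pos, 1, one_mem _, 1, by simp [J], by simp⟩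
  have key : ∀ ρ : R, ρ.1 ≠ 1 → ∃ ρ' : R, ρ'.1 ≠ 1 ∧ g⁻¹ * ρ * ρ'.1⁻¹ ∈ N := by
    intro ρ hρ
    have h1 := hg ⟨1, h1U, ρ, ρ.2, rfl⟩
    simp only [one_mul] at h1
    rw [show (ρ : G) = 1 * ρ by simp, h.eta_of_zero (one_mem _) ρ.2 hρ, one_mul] at h1
    by_contra hcon
    refine hy.2 (g⁻¹ * ρ) (fun hc => hcon ?_) h1
    obtain ⟨δ, hδ, ρ', ⟨hρ', hne⟩, he⟩ := hc
    refine ⟨⟨ρ', hρ'⟩, hne, ?_⟩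
    simp only at he ⊢
    rw [← he, mul_inv_cancel_right]
    exact h.le 1 le_rfl hδ
  -- Including `ρ = 1` gives a self-map of the finite set `R`, so that injectivity yields
  -- surjectivity.
  have key2 : ∀ ρ : R, ∃ ρ' : R, (ρ.1 ≠ 1 → ρ'.1 ≠ 1) ∧ g⁻¹ * ρ * ρ'.1⁻¹ ∈ N := by
    intro ρ
    by_cases hρ : ρ.1 = 1
    · obtain ⟨x, hx, ρ', hρ', he⟩ := h.exists_rep (g⁻¹ * ρ)
      exact ⟨⟨ρ', hρ'⟩, fun hc => absurd hρ hc, by simpa [he] using hx⟩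
    · obtain ⟨ρ', h1, h2⟩ := key ρ hρ
      exact ⟨ρ', fun _ => h1, h2⟩
  choose f hf1 hf2 using key2
  have hinj : Function.Injective f := by
    intro a b hab
    refine Subtype.ext (h.rep_unique a a.2 b b.2 ?_)
    have h1 := mul_mem (hf2 a) (inv_mem (hf2 b))
    rw [hab] at h1
    have h2 := h.normal.conj_mem _ h1 g
    simpa [mul_assoc] using h2
  have : Finite R := h.finite_R
  obtain ⟨a, ha⟩ := (Finite.injective_iff_surjective.1 hinj) ⟨1, h.one_mem_R⟩
  have ha1 : a.1 = 1 := by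
    by_contra hne
    exact hf1 a hne (by rw [ha])
  have h3 := hf2 a
  rw [ha, ha1] at h3
  simpa using h3

/-- The key uniqueness statement: `Γ n` is exactly the group of periods of the skeleton. -/
theorem mem_of_eqOn_shift (hm : 2 ≤ m) {n : ℕ} (hn : 1 ≤ n) {y : G → Fin (m + 1)}
    (hy : y ∈ skeleton Γ D R m (n + 1)) {g : G}
    (hg : EqOn (shift g y) (eta Γ D R m) (periodicPart Γ D n * R)) : g ∈ Γ n := by
  -- The translation cannot move a point of level `k` to a higher level: `y` is constantly `α_{k+1}`
  -- on `g⁻¹ Γ (k + 1) x₀`, and a higher level would put in this set a point of `J (k + 1)`, where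
  -- `y` is `α_{k+2}`.
  have step : ∀ k : ℕ, y ∈ skeleton Γ D R m (k + 2) →
      EqOn (shift g y) (eta Γ D R m) (periodicPart Γ D (k + 1) * R) → ∀ x₀ ∈ J Γ D k, g ∈ N →
      g⁻¹ * x₀ ∈ periodicPart Γ D (k + 1) := by
    intro k hy hg x₀ hx₀ hgN
    have hval : ∀ γ ∈ Γ (k + 1), y (g⁻¹ * (γ * x₀)) = symbol m (k + 1) := by
      intro γ hγ
      have h1 : γ * x₀ ∈ periodicPart Γ D (k + 1) := mem_periodicPart.2 ⟨k, by omega, γ, hγ, x₀, hx₀, rfl⟩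
      have h2 := hg ⟨_, h1, 1, h.one_mem_R, rfl⟩
      simp only [shift] at h2
      rw [h.eta_of_level hγ hx₀ h.one_mem_R (Or.inr rfl), mul_one] at h2
      exact h2
    by_contra hU
    obtain ⟨γ, hγ, z, hz, he⟩ := h.exists_of_notMem_periodicPart (n := k + 1) (by omega)
      (mul_mem (inv_mem hgN) (h.J_subset hx₀)) hU
    have h3 := hval γ⁻¹ (inv_mem hγ)
    have h4 : g⁻¹ * (γ⁻¹ * x₀) = z := by
      rw [← mul_assoc, h.comm _ (inv_mem hgN) _ (inv_mem (h.le _ (by omega) hγ)), mul_assoc, he,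
        inv_mul_cancel_left]
    have h5 : y (z * 1) = eta Γ D R m (z * 1) :=
      hy.1 ⟨z, J_subset_periodicPart (by omega) hz, 1, h.one_mem_R, rfl⟩
    rw [h.eta_J (by omega) hz h.one_mem_R, mul_one] at h5
    rw [h4, h5] at h3
    exact symbol_succ_ne hm k h3
  induction n, hn using Nat.le_induction with
  | base =>
    have hgN := h.mem_of_eqOn_shift_zeros hy hg
    have := step 0 hy hg 1 (by simp [J]) hgN
    obtain ⟨i, hi, γ, hγ, z, hz, he⟩ := mem_periodicPart.1 this
    obtain rfl : i = 0 := by omega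
    obtain rfl := mem_J_zero.1 hz
    have he' : γ = g⁻¹ := by simpa using he
    exact inv_mem_iff.1 (he' ▸ hγ)
  | succ n hn ih =>
    have hgn : g ∈ Γ n := ih (skeleton_anti (by omega) hy)
      (hg.mono (mul_subset_mul_right (periodicPart_mono (by omega))))
    obtain ⟨x₀, hx₀⟩ := h.J_nonempty n
    have := step n hy hg x₀ hx₀ (h.le n hn hgn)
    obtain ⟨i, hi, γ, hγ, z, hz, he⟩ := mem_periodicPart.1 this
    obtain rfl : i = n := by
      by_contra hne
      -- Since `g ∈ Γ n`, the level cannot drop below `n` either. Hence it is exactly `n`, and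
      -- uniqueness of the decomposition modulo `Γ n` identifies `g⁻¹` with an element of `Γ (n +
      -- 1)`.
      have h1 : g⁻¹ * x₀ ∈ periodicPart Γ D n := mem_periodicPart.2 ⟨i, by omega, γ, hγ, z, hz, he⟩
      exact ((mem_J hn).1 hx₀).2 ((h.mul_mem_periodicPart_iff hn (inv_mem hgn)).1 h1)
    have := (h.unique' hn (h.succ_le _ hn hγ) (inv_mem hgn) ((mem_J hn).1 hz).1
      ((mem_J hn).1 hx₀).1 he).1
    exact inv_mem_iff.1 (this ▸ hγ)

theorem per_eta {n : ℕ} (hn : 1 ≤ n) {u ρ : G} (hu : u ∈ periodicPart Γ D n) (hρ : ρ ∈ R) :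
    u * ρ ∈ Per (eta Γ D R m) (Γ n) (eta Γ D R m (u * ρ)) :=
  fun _ hγ => h.eta_mul hn (inv_mem hγ) hu hρ

theorem eqOn_of_per_eq {n : ℕ} (hn : 1 ≤ n) {x : G → Fin (m + 1)}
    (hx : ∀ α, Per x (Γ n) α = Per (eta Γ D R m) (Γ n) α) :
    EqOn x (eta Γ D R m) (periodicPart Γ D n * R) := by
  rintro _ ⟨u, hu, ρ, hρ, rfl⟩
  have h1 := h.per_eta (m := m) hn hu hρ
  rw [← hx] at h1
  simpa using h1 1 (one_mem _)

/-- A `Γ n`-coset outside the periodic part meets both `J n * R` and `J (n + 1) * R`, with different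
symbols. Seeing both levels is why the skeleton has order `n + 2`. -/
theorem per_eq_of_mem_skeleton (hm : 2 ≤ m) {n : ℕ} (hn : 1 ≤ n) {y : G → Fin (m + 1)}
    (hy : y ∈ skeleton Γ D R m (n + 2)) (α : Fin (m + 1)) (g : G) :
    g ∈ Per y (Γ n) α ↔ g ∈ periodicPart Γ D n * R ∧ eta Γ D R m g = α := by
  constructor
  · intro hg
    obtain ⟨x, hx, ρ, hρ, rfl⟩ := h.exists_rep g
    have hxU : x ∈ periodicPart Γ D n := by
      by_contra hU
      obtain ⟨γ, hγ, z, hz, rfl⟩ := h.exists_of_notMem_periodicPart hn hx hU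
      obtain ⟨δ, hδ, hδD, hδ1⟩ := h.exists_ne_one hn
      have h1 := hg γ hγ
      have h2 := hg (γ * δ⁻¹) (mul_mem hγ (inv_mem hδ))
      rw [show γ⁻¹ * (γ * z * ρ) = z * ρ by group,
        hy.1 ⟨z, J_subset_periodicPart (by omega) hz, ρ, hρ, rfl⟩, h.eta_J hn hz hρ] at h1
      have hz' := h.mul_mem_J_succ hn hδ hδD hδ1 hz
      rw [show (γ * δ⁻¹)⁻¹ * (γ * z * ρ) = δ * z * ρ by group,
        hy.1 ⟨_, J_subset_periodicPart (by omega) hz', ρ, hρ, rfl⟩,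
        h.eta_J (by omega) hz' hρ] at h2
      exact symbol_succ_ne hm n (h2.trans h1.symm)
    have hmem : x * ρ ∈ periodicPart Γ D n * R := ⟨x, hxU, ρ, hρ, rfl⟩
    refine ⟨hmem, ?_⟩
    have := hg 1 (one_mem _)
    rw [inv_one, one_mul] at this
    rw [← this, (skeleton_anti (show n ≤ n + 2 by omega) hy).1 hmem]
  · rintro ⟨⟨u, hu, ρ, hρ, rfl⟩, rfl⟩ γ hγ
    have h1 : γ⁻¹ * u ∈ periodicPart Γ D n := h.mul_mem_periodicPart hn (inv_mem hγ) hu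
    have h2 := (skeleton_anti (show n ≤ n + 2 by omega) hy).1 ⟨_, h1, ρ, hρ, rfl⟩
    simp only at h2 ⊢
    rw [← h.eta_mul hn (inv_mem hγ) hu hρ, ← mul_assoc, h2]

/-- Every point of the subshift is in exactly one translate of `C n` modulo `Γ n`. -/
theorem exists_phase (hm : 2 ≤ m) {n : ℕ} (hn : 1 ≤ n) {x : G → Fin (m + 1)}
    (hx : x ∈ subshift Γ D R m) : ∃ c, (∀ a, shift a x ∈ C Γ D R m n ↔ a * c⁻¹ ∈ Γ n) ∧
      ∀ a, EqOn (shift a x) (eta Γ D R m) (periodicPart Γ D n * R) ↔ a * c⁻¹ ∈ Γ n := by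
  obtain ⟨c, hc⟩ := h.exists_shift_mem_skeleton hm (n := n + 2) (by omega) hx
  have hshift : ∀ a, shift a x = shift (a * c⁻¹) (shift c x) := fun a => by
    rw [← shift_mul, inv_mul_cancel_right]
  have h1 : ∀ a, EqOn (shift a x) (eta Γ D R m) (periodicPart Γ D n * R) ↔ a * c⁻¹ ∈ Γ n := by
    intro a
    rw [hshift]
    constructor
    · exact h.mem_of_eqOn_shift hm hn (skeleton_anti (by omega) hc)
    · exact fun ha => (h.shift_mem_skeleton hn ha (skeleton_anti (by omega) hc)).1
  refine ⟨c, fun a => ⟨fun ha => (h1 a).1 (h.eqOn_of_per_eq hn ha.2), fun ha => ?_⟩, h1⟩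
  refine ⟨shift_mem_orbitClosure _ a hx, fun α => ?_⟩
  rw [hshift, per_shift ha]
  ext g
  rw [h.per_eq_of_mem_skeleton hm hn hc,
    h.per_eq_of_mem_skeleton hm hn (h.eta_mem_skeleton hm (n + 2))]

end TilingData

end Combinatorics

/-! ### Weak-* limit points of sequences of measures -/

section LimitMeasures

/-- Weak limit points give at most mass `c` to open sets of eventually at most mass `c`. -/
theorem IsWeakLimitPoint.apply_le_of_isOpen {X : Type*} [TopologicalSpace X] [MeasurableSpace X]
    [OpensMeasurableSpace X] [HasOuterApproxClosed X] {M : ℕ → Measure X}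
    {ν : ProbabilityMeasure X} (hν : IsWeakLimitPoint M ν) {O : Set X} (hO : IsOpen O) {c : ℝ≥0∞}
    (hc : ∀ᶠ s in atTop, M s O ≤ c) : (ν : Measure X) O ≤ c := by
  obtain ⟨P, hP, hcl⟩ := hν
  -- An ultrafilter finer than `atTop` turns the cluster point into a limit, so the portmanteau
  -- inequality for open sets applies.
  obtain ⟨U, hU, hlim⟩ := mapClusterPt_iff_ultrafilter.1 hcl
  refine (ProbabilityMeasure.le_liminf_measure_open_of_tendsto hlim hO).trans ?_
  refine liminf_le_of_frequently_le' (Eventually.frequently ?_)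
  filter_upwards [hU hP, hU hc] with s h1 h2
  rwa [h1]

/-- Weak limit points are invariant under maps preserving the approximating measures. -/
theorem IsWeakLimitPoint.map_eq {X : Type*} [TopologicalSpace X] [MeasurableSpace X]
    [BorelSpace X] [HasOuterApproxClosed X] {M : ℕ → Measure X}
    {ν : ProbabilityMeasure X} (hν : IsWeakLimitPoint M ν) {f : X → X} (hf : Continuous f)
    (hM : ∀ᶠ s in atTop, (M s).map f = M s) : (ν : Measure X).map f = ν := by
  obtain ⟨P, hP, hcl⟩ := hν
  obtain ⟨U, hU, hlim⟩ := mapClusterPt_iff_ultrafilter.1 hcl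
  have h1 := ProbabilityMeasure.tendsto_map_of_tendsto_of_continuous P ν hlim hf
  have h2 : (fun s => (P s).map hf.measurable.aemeasurable) =ᶠ[U] P := by
    filter_upwards [hU hP, hU hM] with s h1 h2
    apply Subtype.ext
    change (P s : Measure X).map f = P s
    rw [h1, h2]
  have h3 := tendsto_nhds_unique (h1.congr' h2) hlim
  exact congrArg Subtype.val h3

theorem exists_isWeakLimitPoint {X : Type*} [TopologicalSpace X] [MeasurableSpace X]
    [BorelSpace X] [Nonempty X]
    [CompactSpace (ProbabilityMeasure X)] {M : ℕ → Measure X}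
    (hM : ∀ᶠ s in atTop, IsProbabilityMeasure (M s)) :
    ∃ ν : ProbabilityMeasure X, IsWeakLimitPoint M ν := by
  classical
  obtain ⟨x⟩ := ‹Nonempty X›
  -- The Dirac mass is a default at indices where `M s` is not a probability measure; it is
  -- eventually not used.
  let P : ℕ → ProbabilityMeasure X := fun s =>
    if h : IsProbabilityMeasure (M s) then ⟨M s, h⟩ else ⟨Measure.dirac x, inferInstance⟩
  obtain ⟨ν, hν⟩ := exists_clusterPt_of_compactSpace (map P atTop)
  refine ⟨ν, P, ?_, hν⟩
  filter_upwards [hM] with s hs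
  have : P s = ⟨M s, hs⟩ := dif_pos hs
  rw [this]
  rfl

end LimitMeasures

/-! ### The periodic measures: invariance, counting estimates, and their limits -/

section PeriodicMeasures

variable {G : Type*} [Group G] {N : Subgroup G} {Γ : ℕ → Subgroup G} {D : ℕ → Set G} {R : Set G}
  {m : ℕ}

/-- A telescoping geometric series; keeping the term `t / 2 ^ n` lets the induction close. -/
theorem sum_Ico_le_of_le_div_two_pow {b : ℕ → ℝ} {t : ℝ} {k n : ℕ} (hkn : k ≤ n)
    (hb : ∀ j, k ≤ j → j < n → b j ≤ t / 2 ^ (j + 1)) :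
    ∑ j ∈ Finset.Ico k n, b j ≤ t / 2 ^ k - t / 2 ^ n := by
  induction n, hkn using Nat.le_induction with
  | base => simp
  | succ n hkn ih =>
    rw [Finset.sum_Ico_succ_top hkn]
    have h1 := ih fun j h1 h2 => hb j h1 (by omega)
    have h2 := hb n hkn (by omega)
    have h3 : t / 2 ^ n = t / 2 ^ (n + 1) + t / 2 ^ (n + 1) := by
      rw [pow_succ]; field_simp; ring
    linarith

theorem measurable_shift [Countable G] (g : G) :
    Measurable (shift g : (G → Fin (m + 1)) → (G → Fin (m + 1))) :=
  (continuous_shift g).measurable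

/-- The arrays that follow, around the identity, the pattern of `η` on `D n * R` with the symbol
`i` on `J n * R`, at some phase. -/
def symbolSet (Γ : ℕ → Subgroup G) (D : ℕ → Set G) (R : Set G) (m n : ℕ) (i : Fin (m + 1)) :
    Set (G → Fin (m + 1)) :=
  {x | ∃ v ∈ D n * R, EqOn (shift v x) (eta Γ D R m) (periodicPart Γ D n * R) ∧
    ∀ g ∈ J Γ D n * R, shift v x g = i}

/-- The arrays with a pattern of `η` on the finite set `F`. -/
def windowSet (y : G → Fin (m + 1)) (F : Finset G) : Set (G → Fin (m + 1)) :=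
  {x | ∃ g : G, ∀ k ∈ F, x k = y (g * k)}

theorem isClopen_windowSet (y : G → Fin (m + 1)) (F : Finset G) : IsClopen (windowSet y F) := by
  have : windowSet y F = (fun (x : G → Fin (m + 1)) (k : F) => x k) ⁻¹'
      {z | ∃ g : G, ∀ k : F, z k = y (g * k)} := by
    ext x; simp [windowSet]
  rw [this]
  exact (isClopen_discrete _).preimage (continuous_pi fun k => continuous_apply (k : G))

/-- Basic open sets constrain finitely many coordinates. The subshift thus becomes an intersection
of clopen sets, to which weak-* limits can be applied one at a time. -/
theorem iInter_windowSet (y : G → Fin (m + 1)) : ⋂ F, windowSet y F = orbitClosure y := by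
  ext x
  rw [mem_iInter]
  constructor
  · intro hx
    refine mem_closure_iff.2 fun t ht hxt => ?_
    obtain ⟨F, u, hu, hsub⟩ := isOpen_pi_iff.1 ht x hxt
    obtain ⟨g, hg⟩ := hx F
    refine ⟨shift g⁻¹ y, hsub fun k hk => ?_, ⟨g⁻¹, rfl⟩⟩
    have := hg k hk
    rw [shift, inv_inv, ← this]
    exact (hu k hk).2
  · intro hx F
    refine closure_minimal ?_ (isClopen_windowSet y F).isClosed hx
    rintro _ ⟨g, rfl⟩
    exact ⟨g⁻¹, fun k _ => rfl⟩

namespace TilingData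

variable (h : TilingData N Γ D R)
include h

theorem etaPeriodic_mul {n : ℕ} (hn : 1 ≤ n) {γ u : G} (hγ : γ ∈ Γ n) (hu : u ∈ D n * R) :
    etaPeriodic Γ D R m n (γ * u) = eta Γ D R m u := by
  have hex : ∃ v ∈ D n * R, γ * u * v⁻¹ ∈ Γ n := ⟨u, hu, by simpa using hγ⟩
  rw [etaPeriodic, dif_pos hex]
  have h1 := hex.choose_spec
  refine congrArg _ (h.D_mul_R_unique hn hu h1.1 ?_).symm
  simpa [mul_assoc] using mul_mem (inv_mem hγ) h1.2

theorem etaPeriodic_left {n : ℕ} (hn : 1 ≤ n) {γ : G} (hγ : γ ∈ Γ n) (g : G) :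
    etaPeriodic Γ D R m n (γ * g) = etaPeriodic Γ D R m n g := by
  obtain ⟨δ, hδ, u, hu, rfl⟩ := h.exists_mul_D_mul_R hn g
  rw [← mul_assoc, h.etaPeriodic_mul hn (mul_mem hγ hδ) hu, h.etaPeriodic_mul hn hδ hu]

theorem shift_etaPeriodic {n : ℕ} (hn : 1 ≤ n) {γ : G} (hγ : γ ∈ Γ n) :
    shift γ (etaPeriodic Γ D R m n) = etaPeriodic Γ D R m n :=
  funext fun g => h.etaPeriodic_left hn (inv_mem hγ) g

theorem etaPeriodic_eqOn {n : ℕ} (hn : 1 ≤ n) :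
    EqOn (etaPeriodic Γ D R m n) (eta Γ D R m) (periodicPart Γ D n * R) := by
  rintro _ ⟨x, hx, ρ, hρ, rfl⟩
  obtain ⟨γ, hγ, d, hd, rfl⟩ := h.exists_mul n hn x (h.periodicPart_subset hx)
  have hdU := (h.mul_mem_periodicPart_iff hn hγ).1 hx
  simp only
  rw [mul_assoc, h.etaPeriodic_mul hn hγ ⟨d, hd, ρ, hρ, rfl⟩, h.eta_mul hn hγ hdU hρ]

/-- Each hole is a `Γ n`-translate of a point of `J n * R`, where `η` is constant. So the residue of
`n` modulo `m` decides which symbol fills all the holes. -/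
theorem etaPeriodic_of_notMem {n : ℕ} (hn : 1 ≤ n) {x ρ : G} (hx : x ∈ N) (hρ : ρ ∈ R)
    (hxU : x ∉ periodicPart Γ D n) : etaPeriodic Γ D R m n (x * ρ) = symbol m (n + 1) := by
  obtain ⟨γ, hγ, y, hy, rfl⟩ := h.exists_of_notMem_periodicPart hn hx hxU
  rw [mul_assoc, h.etaPeriodic_mul hn hγ ⟨y, ((mem_J hn).1 hy).1, ρ, hρ, rfl⟩, h.eta_J hn hy hρ]

theorem D_mul_R_nonempty {n : ℕ} (hn : 1 ≤ n) : (D n * R).Nonempty :=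
  ⟨1, 1, h.one_mem_D n hn, 1, h.one_mem_R, mul_one 1⟩

theorem ncard_D_mul_R_pos {n : ℕ} (hn : 1 ≤ n) : 0 < (D n * R).ncard :=
  (Set.ncard_pos (h.finite_D_mul_R hn)).2 (h.D_mul_R_nonempty hn)

theorem periodicMeasure_apply {n : ℕ} (hn : 1 ≤ n) {E : Set (G → Fin (m + 1))}
    (hE : MeasurableSet E) :
    periodicMeasure Γ D R m n E = ((D n * R).ncard : ℝ≥0∞)⁻¹ *
      ({u ∈ D n * R | shift u⁻¹ (etaPeriodic Γ D R m n) ∈ E}.ncard : ℝ≥0∞) := by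
  classical
  have hfin := h.finite_D_mul_R hn
  have := hfin.fintype
  rw [periodicMeasure, Measure.smul_apply, smul_eq_mul, Measure.sum_apply _ hE, tsum_fintype]
  congr 1
  simp only [Measure.dirac_apply' _ hE, Set.indicator_apply, Pi.one_apply]
  rw [Finset.sum_boole, ← Set.ncard_coe_finset,
    ← Set.ncard_image_of_injective _ Subtype.val_injective]
  congr 2
  ext u
  simp [and_comm]

theorem isProbabilityMeasure_periodicMeasure {n : ℕ} (hn : 1 ≤ n) :
    IsProbabilityMeasure (periodicMeasure Γ D R m n) := by
  constructor
  rw [h.periodicMeasure_apply hn MeasurableSet.univ]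
  simp only [mem_univ, and_true, ofPred_mem_eq]
  refine ENNReal.inv_mul_cancel ?_ (ENNReal.natCast_ne_top _)
  exact_mod_cast (h.ncard_D_mul_R_pos hn).ne'

/-- Upper bounds for periodic measures from counting. -/
theorem periodicMeasure_le {n : ℕ} (hn : 1 ≤ n) {E : Set (G → Fin (m + 1))}
    (hE : MeasurableSet E) {a : ℕ} {c : ℕ} (ha : a ≠ 0)
    (hc : a * {u ∈ D n * R | shift u⁻¹ (etaPeriodic Γ D R m n) ∈ E}.ncard ≤ c * (D n * R).ncard) :
    periodicMeasure Γ D R m n E ≤ (c : ℝ≥0∞) / a := by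
  rw [h.periodicMeasure_apply hn hE, ENNReal.le_div_iff_mul_le (by simp [ha]) (by simp)]
  have h1 : ((D n * R).ncard : ℝ≥0∞) ≠ 0 := by
    exact_mod_cast (h.ncard_D_mul_R_pos hn).ne'
  rw [mul_assoc, mul_comm, ← div_eq_mul_inv]
  refine ENNReal.div_le_of_le_mul ?_
  rw [mul_comm _ (a : ℝ≥0∞)]
  exact_mod_cast hc

/-- Right multiplication by `g⁻¹`, followed by reduction modulo `Γ n`, is an injection of `D n * R`
into itself, and `η_n` does not see the reduction. Using `g` and `g⁻¹` gives equality, hence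
invariance of the measure. -/
theorem ncard_shift_le {n : ℕ} (hn : 1 ≤ n) (g : G) (E : Set (G → Fin (m + 1))) :
    {u ∈ D n * R | shift u⁻¹ (etaPeriodic Γ D R m n) ∈ shift g ⁻¹' E}.ncard ≤
      {u ∈ D n * R | shift u⁻¹ (etaPeriodic Γ D R m n) ∈ E}.ncard := by
  have hex : ∀ u : G, ∃ v ∈ D n * R, ∃ γ ∈ Γ n, u * g⁻¹ = γ * v := fun u => by
    obtain ⟨γ, hγ, v, hv, he⟩ := h.exists_mul_D_mul_R hn (u * g⁻¹)
    exact ⟨v, hv, γ, hγ, he⟩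
  choose f hf γ hγ he using hex
  refine Set.ncard_le_ncard_of_injOn f ?_ ?_ ((h.finite_D_mul_R hn).subset (sep_subset _ _))
  · rintro u ⟨-, huE⟩
    refine ⟨hf u, ?_⟩
    rw [mem_preimage, ← shift_mul] at huE
    have h1 : g * u⁻¹ = (f u)⁻¹ * (γ u)⁻¹ := by
      rw [← mul_inv_rev, ← he]; group
    rwa [h1, shift_mul, h.shift_etaPeriodic hn (inv_mem (hγ u))] at huE
  · rintro u ⟨hu, -⟩ v ⟨hv, -⟩ huv
    refine h.D_mul_R_unique hn hu hv ?_
    have h1 : u = γ u * f u * g := by rw [← he]; group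
    have h2 : v = γ v * f v * g := by rw [← he]; group
    have h3 : u * v⁻¹ = γ u * (γ v)⁻¹ := by
      conv_lhs => rw [h1, h2, huv]
      group
    rw [h3]
    exact mul_mem (hγ u) (inv_mem (hγ v))

theorem map_shift_periodicMeasure [Countable G] {n : ℕ} (hn : 1 ≤ n) (g : G) :
    (periodicMeasure Γ D R m n).map (shift g) = periodicMeasure Γ D R m n := by
  ext E hE
  rw [Measure.map_apply (measurable_shift g) hE, h.periodicMeasure_apply hn hE,
    h.periodicMeasure_apply hn (measurable_shift g hE)]
  congr 2
  refine le_antisymm (h.ncard_shift_le hn g E) ?_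
  have h1 := h.ncard_shift_le (m := m) hn g⁻¹ (shift g ⁻¹' E)
  rw [← preimage_comp] at h1
  have h2 : shift g ∘ shift g⁻¹ = (id : (G → Fin (m + 1)) → _) :=
    funext fun x => shift_shift_inv g x
  rwa [h2, preimage_id] at h1

/-! ### Counting -/

/-- The proportion of the points of `D n * R` in `Γ (j + 1) * D j * R`. -/
theorem ncard_level_le {j n : ℕ} (hj : 1 ≤ j) (hjn : j < n) :
    2 ^ (j + 1) * {u ∈ D n * R | u ∈ (Γ (j + 1) : Set G) * D j * R}.ncard ≤ (D n * R).ncard := by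
  have hdec : ∀ u ∈ {u ∈ D n * R | u ∈ (Γ (j + 1) : Set G) * D j * R},
      ∃ γ ∈ Γ (j + 1), γ ∈ D n ∧ ∃ d ∈ D j, ∃ ρ ∈ R, u = γ * d * ρ := by
    rintro _ ⟨⟨e, he, ρ, hρ, rfl⟩, ⟨_, ⟨γ, hγ, d, hd, rfl⟩, ρ', hρ', heq⟩⟩
    simp only [] at heq
    obtain ⟨rfl, rfl⟩ := h.rep_unique' (mul_mem (h.le _ (by omega) hγ) (h.subset j hj hd))
      (h.subset n (by omega) he) hρ' hρ heq
    obtain ⟨δ, hδ, hδn, d', hd', he'⟩ := h.tile_exists_of_le (by omega) (show j + 1 ≤ n from hjn) he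
    obtain ⟨rfl, rfl⟩ := h.unique' (by omega) hγ hδ (h.D_mono hj (by omega) hd) hd' he'
    exact ⟨γ, hγ, hδn, d, hd, ρ', hρ', rfl⟩
  have hcomm : ∀ δ ∈ Γ j, ∀ γ ∈ Γ (j + 1), ∀ d ρ : G, δ * (γ * d * ρ) = γ * (δ * d) * ρ := by
    intro δ hδ γ hγ d ρ
    have := h.comm δ (h.le j hj hδ) γ (h.le _ (by omega) hγ)
    rw [← mul_assoc, ← mul_assoc, ← mul_assoc, this]
  -- The at least `2 ^ (j + 1)` elements `δ` of `D (j + 1) ∩ Γ j` move the set to pairwise disjoint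
  -- subsets of `D n * R`: inside each tile `γ D (j + 1)`, they move `γ D j` to the different
  -- subtiles.
  refine (Nat.mul_le_mul_right _ (h.growth j hj)).trans ?_
  rw [← Set.ncard_prod]
  refine Set.ncard_le_ncard_of_injOn (fun q : G × G => q.1 * q.2) ?_ ?_ (h.finite_D_mul_R (by omega))
  · rintro ⟨δ, u⟩ ⟨⟨hδD, hδ⟩, hu⟩
    obtain ⟨γ, hγ, hγn, d, hd, ρ, hρ, rfl⟩ := hdec u hu
    simp only []
    rw [hcomm δ hδ γ hγ]
    exact ⟨_, h.tile_mem_of_le (by omega) hjn hγ hγn (h.tile_mem j hj δ hδ hδD d hd), ρ, hρ, rfl⟩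
  · rintro ⟨δ, u⟩ ⟨⟨hδD, hδ⟩, hu⟩ ⟨δ', u'⟩ ⟨⟨hδD', hδ'⟩, hu'⟩ heq
    obtain ⟨γ, hγ, hγn, d, hd, ρ, hρ, rfl⟩ := hdec u hu
    obtain ⟨γ', hγ', hγn', d', hd', ρ', hρ', rfl⟩ := hdec u' hu'
    simp only [] at heq hδD hδ hδD' hδ'
    rw [hcomm δ hδ γ hγ, hcomm δ' hδ' γ' hγ'] at heq
    have hm1 := h.tile_mem j hj δ hδ hδD d hd
    have hm2 := h.tile_mem j hj δ' hδ' hδD' d' hd'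
    obtain ⟨h1, rfl⟩ := h.rep_unique' (mul_mem (h.le _ (by omega) hγ) (h.subset _ (by omega) hm1))
      (mul_mem (h.le _ (by omega) hγ') (h.subset _ (by omega) hm2)) hρ hρ' heq
    obtain ⟨rfl, h2⟩ := h.unique' (by omega) hγ hγ' hm1 hm2 h1
    obtain ⟨rfl, rfl⟩ := h.unique' hj hδ hδ' hd hd' h2
    rfl

/-- Write `u = γ v` with `v ∈ D k * R`. The pattern can fail only if `γ * J k` meets a level `j`
with `k ≤ j < n`. Since `D j` is a union of `k`-tiles, all of `γ * D k` then lies in one translate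
of `D j` by `Γ (j + 1)`, and `u` is in that translate times `R`. -/
theorem exists_level_of_notMem_symbolSet {k n : ℕ} (hk : 1 ≤ k) (hkn : k ≤ n) {u : G}
    (hbad : shift u⁻¹ (etaPeriodic Γ D R m n) ∉ symbolSet Γ D R m k (symbol m (n + 1))) :
    ∃ j ∈ Finset.Ico k n, u ∈ (Γ (j + 1) : Set G) * D j * R := by
  obtain ⟨γ, hγ, v, hv, rfl⟩ := h.exists_mul_D_mul_R hk u
  have hsh : shift v (shift (γ * v)⁻¹ (etaPeriodic Γ D R m n)) =
      shift γ⁻¹ (etaPeriodic Γ D R m n) := by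
    rw [← shift_mul]; congr 1; group
  by_contra! hcon
  refine hbad ⟨v, hv, ?_, ?_⟩ <;> rw [hsh]
  · refine h.eqOn_shift hk (inv_mem hγ) ?_
    exact (h.etaPeriodic_eqOn (by omega)).mono (mul_subset_mul_right (periodicPart_mono hkn))
  · rintro _ ⟨y, hy, ρ, hρ, rfl⟩
    simp only [shift, inv_inv]
    rw [← mul_assoc]
    refine h.etaPeriodic_of_notMem (by omega) (mul_mem (h.le k hk hγ) (h.J_subset hy)) hρ
      fun hU => ?_
    obtain ⟨j, hj, δ, hδ, z, hz, he⟩ := mem_periodicPart.1 hU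
    have hkj : k ≤ j := by
      by_contra hlt
      have : γ * y ∈ periodicPart Γ D k := mem_periodicPart.2 ⟨j, by omega, δ, hδ, z, hz, he⟩
      exact ((mem_J hk).1 hy).2 ((h.mul_mem_periodicPart_iff hk hγ).1 this)
    refine hcon j (Finset.mem_Ico.2 ⟨hkj, hj⟩) ?_
    obtain ⟨ε, hε, hεj, d, hd, rfl⟩ := h.tile_exists_of_le hk hkj ((mem_J (by omega)).1 hz).1
    rw [← mul_assoc] at he
    have hδk : δ ∈ Γ k := h.anti hk (by omega) hδ
    obtain ⟨rfl, rfl⟩ := h.unique' hk (mul_mem hδk hε) hγ hd ((mem_J hk).1 hy).1 he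
    obtain ⟨d', hd', ρ', hρ', rfl⟩ := hv
    refine ⟨δ * (ε * d'), ⟨δ, hδ, ε * d', h.tile_mem_of_le hk hkj hε hεj hd', rfl⟩, ρ', hρ', ?_⟩
    simp only [mul_assoc]

theorem ncard_notMem_symbolSet_le {k n : ℕ} (hk : 1 ≤ k) (hkn : k ≤ n) :
    2 ^ k * {u ∈ D n * R | shift u⁻¹ (etaPeriodic Γ D R m n) ∈
      (symbolSet Γ D R m k (symbol m (n + 1)))ᶜ}.ncard ≤ (D n * R).ncard := by
  set B : ℕ → Set G := fun j => {u ∈ D n * R | u ∈ (Γ (j + 1) : Set G) * D j * R} with hB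
  have hfin := h.finite_D_mul_R (n := n) (by omega)
  have hsub : {u ∈ D n * R | shift u⁻¹ (etaPeriodic Γ D R m n) ∈
      (symbolSet Γ D R m k (symbol m (n + 1)))ᶜ} ⊆ ⋃ j ∈ Finset.Ico k n, B j := by
    rintro u ⟨hu, hbad⟩
    obtain ⟨j, hj, huj⟩ := h.exists_level_of_notMem_symbolSet hk hkn hbad
    exact mem_biUnion hj ⟨hu, huj⟩
  have h1 := (Set.ncard_le_ncard hsub (hfin.subset (iUnion₂_subset fun j _ => sep_subset _ _))).trans
    (Finset.set_ncard_biUnion_le _ _)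
  have h2 := sum_Ico_le_of_le_div_two_pow (b := fun j => ((B j).ncard : ℝ))
    (t := ((D n * R).ncard : ℝ)) hkn fun j hj1 hj2 => by
      rw [le_div_iff₀ (by positivity), mul_comm]
      exact_mod_cast h.ncard_level_le (by omega) hj2
  have h3 : (0 : ℝ) ≤ ((D n * R).ncard : ℝ) / 2 ^ n := by positivity
  have h4 : ∑ j ∈ Finset.Ico k n, ((B j).ncard : ℝ) ≤ ((D n * R).ncard : ℝ) / 2 ^ k := by linarith
  rw [le_div_iff₀ (by positivity), mul_comm] at h4
  exact (Nat.mul_le_mul_left _ h1).trans (by exact_mod_cast h4)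

/-- With `ρ * g = x ρ * ρ' ρ`, commutativity of `N` gives `d * ρ * g = x ρ * d * ρ' ρ`. This reduces
to the Følner property in `N` for the finitely many `x ρ` with `ρ ∈ R`. -/
theorem folner_D_mul_R (g : G) : ∃ c : ℕ, ∀ n, 1 ≤ n →
    n * {u ∈ D n * R | u * g ∉ D n * R}.ncard ≤ c * (D n * R).ncard := by
  have hex : ∀ ρ : G, ∃ x ∈ N, ∃ ρ' ∈ R, ρ * g = x * ρ' := fun ρ => h.exists_rep _
  choose x hx ρ' hρ' he using hex
  choose c hc using fun ρ => h.folner (x ρ) (hx ρ)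
  refine ⟨∑ ρ ∈ h.finite_R.toFinset, c ρ, fun n hn => ?_⟩
  set B : G → Set G := fun ρ => (fun d => d * ρ) '' {d ∈ D n | x ρ * d ∉ D n} with hB
  have hsub : {u ∈ D n * R | u * g ∉ D n * R} ⊆ ⋃ ρ ∈ h.finite_R.toFinset, B ρ := by
    rintro _ ⟨⟨d, hd, ρ, hρ, rfl⟩, hbad⟩
    refine mem_biUnion (x := ρ) (by simpa using hρ) ⟨d, ⟨hd, fun hc => hbad ?_⟩, rfl⟩
    refine ⟨_, hc, ρ' ρ, hρ' ρ, ?_⟩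
    simp only []
    rw [h.comm _ (hx ρ) _ (h.subset n hn hd), mul_assoc, mul_assoc, he]
  have hBfin : ∀ ρ, (B ρ).Finite := fun ρ => ((h.finite n hn).subset (sep_subset _ _)).image _
  have h1 := (Set.ncard_le_ncard hsub (Finset.finite_toSet _ |>.biUnion fun ρ _ => hBfin ρ)).trans
    (Finset.set_ncard_biUnion_le _ _)
  refine (Nat.mul_le_mul_left _ h1).trans ?_
  rw [Finset.mul_sum, Finset.sum_mul]
  refine Finset.sum_le_sum fun ρ _ => ?_
  refine (Nat.mul_le_mul_left _ (Set.ncard_image_le ((h.finite n hn).subset (sep_subset _ _)))).trans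
    ((hc ρ n hn).trans (Nat.mul_le_mul_left _ (Set.ncard_le_ncard ?_ (h.finite_D_mul_R hn))))
  exact fun d hd => ⟨d, hd, 1, h.one_mem_R, mul_one d⟩

/-- If `u * k ∈ D n * R` for all `k ∈ F`, then `η_n` and `η` agree at these points. Only positions
`u` near the boundary can be bad. -/
theorem ncard_notMem_windowSet_le (F : Finset G) : ∃ c : ℕ, ∀ n, 1 ≤ n →
    n * {u ∈ D n * R | shift u⁻¹ (etaPeriodic Γ D R m n) ∈
      (windowSet (eta Γ D R m) F)ᶜ}.ncard ≤ c * (D n * R).ncard := by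
  choose c hc using h.folner_D_mul_R
  refine ⟨∑ k ∈ F, c k, fun n hn => ?_⟩
  have hfin := h.finite_D_mul_R hn
  have hsub : {u ∈ D n * R | shift u⁻¹ (etaPeriodic Γ D R m n) ∈ (windowSet (eta Γ D R m) F)ᶜ} ⊆
      ⋃ k ∈ F, {u ∈ D n * R | u * k ∉ D n * R} := by
    rintro u ⟨hu, hbad⟩
    by_contra hcon
    simp only [mem_iUnion, mem_ofPred_eq, not_exists, not_and, not_not] at hcon
    refine hbad ⟨u, fun k hk => ?_⟩
    have := h.etaPeriodic_mul (m := m) hn (one_mem _) (hcon k hk hu)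
    simpa [shift] using this
  have h1 := (Set.ncard_le_ncard hsub (hfin.subset (iUnion₂_subset fun j _ => sep_subset _ _))).trans
    (Finset.set_ncard_biUnion_le _ _)
  refine (Nat.mul_le_mul_left _ h1).trans ?_
  rw [Finset.mul_sum, Finset.sum_mul]
  exact Finset.sum_le_sum fun k _ => hc k n hn

/-! ### The limit measures -/

theorem isClosed_symbolSet {n : ℕ} (hn : 1 ≤ n) (i : Fin (m + 1)) :
    IsClosed (symbolSet Γ D R m n i) := by
  have : symbolSet Γ D R m n i = ⋃ v ∈ D n * R, shift v ⁻¹'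
      ({x | EqOn x (eta Γ D R m) (periodicPart Γ D n * R)} ∩ {x | EqOn x (fun _ => i) (J Γ D n * R)}) := by
    ext x
    simp only [symbolSet, mem_ofPred_eq, mem_iUnion, mem_preimage, mem_inter_iff, EqOn, exists_prop]
  rw [this]
  exact (h.finite_D_mul_R hn).isClosed_biUnion fun v _ =>
    ((isClosed_setOf_eqOn _ _).inter (isClosed_setOf_eqOn _ _)).preimage (continuous_shift v)

variable [Countable G] {a : ℕ → ℕ} {ν : ProbabilityMeasure (G → Fin (m + 1))}

/-- The complement is a countable union, over finite windows, of open sets whose mass is at most `c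
/ b` for every `b ≥ 1`. -/
theorem measure_compl_subshift (ha : Tendsto a atTop atTop)
    (hν : IsWeakLimitPoint (fun s => periodicMeasure Γ D R m (a s)) ν) :
    (ν : Measure (G → Fin (m + 1))) (subshift Γ D R m)ᶜ = 0 := by
  rw [subshift, ← iInter_windowSet, compl_iInter, measure_iUnion_null_iff]
  intro F
  obtain ⟨c, hc⟩ := h.ncard_notMem_windowSet_le (m := m) F
  have hopen := (isClopen_windowSet (eta Γ D R m) F).compl.isOpen
  have key : ∀ b : ℕ, 1 ≤ b →
      (ν : Measure (G → Fin (m + 1))) (windowSet (eta Γ D R m) F)ᶜ ≤ (c : ℝ≥0∞) / b := by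
    intro b hb
    refine hν.apply_le_of_isOpen hopen ?_
    filter_upwards [ha.eventually_ge_atTop b] with s hs
    refine h.periodicMeasure_le (by omega) hopen.measurableSet (by omega) ?_
    exact (Nat.mul_le_mul_right _ hs).trans (hc _ (by omega))
  have hlim : Tendsto (fun b : ℕ => (c : ℝ≥0∞) / b) atTop (𝓝 0) :=
    ENNReal.Tendsto.const_div ENNReal.tendsto_nat_nhds_top (by simp) |>.trans (by simp)
  refine le_antisymm (ge_of_tendsto hlim ?_) zero_le
  filter_upwards [eventually_ge_atTop 1] with b hb using key b hb

theorem measure_compl_symbolSet_le (ha : Tendsto a atTop atTop)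
    (hν : IsWeakLimitPoint (fun s => periodicMeasure Γ D R m (a s)) ν) {i : Fin (m + 1)}
    (hi : ∀ᶠ s in atTop, symbol m (a s + 1) = i) {k : ℕ} (hk : 1 ≤ k) :
    (ν : Measure (G → Fin (m + 1))) (symbolSet Γ D R m k i)ᶜ ≤ 1 / 2 ^ k := by
  have hopen := (h.isClosed_symbolSet (m := m) hk i).isOpen_compl
  refine hν.apply_le_of_isOpen hopen ?_
  filter_upwards [ha.eventually_ge_atTop k, hi] with s hs hsi
  have := h.periodicMeasure_le (n := a s) (a := 2 ^ k) (c := 1) (by omega) hopen.measurableSet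
    (by positivity) (by
      rw [one_mul, ← hsi]
      exact h.ncard_notMem_symbolSet_le hk hs)
  simpa using this

theorem map_shift_of_isWeakLimitPoint (ha : Tendsto a atTop atTop)
    (hν : IsWeakLimitPoint (fun s => periodicMeasure Γ D R m (a s)) ν) (g : G) :
    (ν : Measure (G → Fin (m + 1))).map (shift g) = ν := by
  refine hν.map_eq (continuous_shift g) ?_
  filter_upwards [ha.eventually_ge_atTop 1] with s hs
  exact h.map_shift_periodicMeasure hs g

end TilingData

end PeriodicMeasures

/-! ### Topology and unique ergodicity of the odometer -/

section OdometerTheory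

variable {G : Type*} [Group G] {Γ : ℕ → Subgroup G}

theorem RightCosets.translate_one (H : Subgroup G) (c : RightCosets H) :
    RightCosets.translate H 1 c = c := by
  obtain ⟨a, rfl⟩ := RightCosets.exists_mk H c
  rw [RightCosets.translate_mk, inv_one, mul_one]

theorem RightCosets.translate_mul (H : Subgroup G) (g g' : G) (c : RightCosets H) :
    RightCosets.translate H (g * g') c =
      RightCosets.translate H g (RightCosets.translate H g' c) := by
  obtain ⟨a, rfl⟩ := RightCosets.exists_mk H c
  rw [RightCosets.translate_mk, RightCosets.translate_mk, RightCosets.translate_mk, mul_inv_rev,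
    mul_assoc]

theorem odometerAction_one (z : Odometer Γ) : odometerAction Γ 1 z = z :=
  Odometer.ext (funext fun n => RightCosets.translate_one _ (z.coord n))

theorem odometerAction_mul (g g' : G) (z : Odometer Γ) :
    odometerAction Γ (g * g') z = odometerAction Γ g (odometerAction Γ g' z) :=
  Odometer.ext (funext fun n => RightCosets.translate_mul _ g g' (z.coord n))

theorem Odometer.continuous_coord (n : ℕ) : Continuous fun z : Odometer Γ => z.coord n :=
  (continuous_apply n).comp continuous_induced_dom

theorem continuous_odometerAction (g : G) : Continuous (odometerAction Γ g) := by
  refine continuous_induced_rng.2 (continuous_pi fun n => ?_)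
  exact continuous_of_discreteTopology.comp (Odometer.continuous_coord n)

theorem Odometer.coord_injective : Function.Injective (Odometer.coord : Odometer Γ → _) :=
  fun _ _ => Odometer.ext

instance : T2Space (Odometer Γ) :=
  T2Space.of_injective_continuous Odometer.coord_injective continuous_induced_dom

theorem Odometer.coord_eq_of_le {z w : Odometer Γ} {k n : ℕ} (hkn : k ≤ n)
    (he : z.coord n = w.coord n) : z.coord k = w.coord k := by
  induction n, hkn using Nat.le_induction with
  | base => exact he
  | succ n hkn ih =>
    obtain ⟨g, hg⟩ := RightCosets.exists_mk _ (z.coord (n + 1))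
    exact ih ((z.compatible n g hg).trans (w.compatible n g (he ▸ hg)).symm)

/-- The cylinder sets of the odometer. -/
def Odometer.cylinder (n : ℕ) (c : RightCosets (Γ (n + 1))) : Set (Odometer Γ) :=
  {z | z.coord n = c}

/-- The collection of all cylinder sets. -/
def Odometer.cylinders (Γ : ℕ → Subgroup G) : Set (Set (Odometer Γ)) :=
  range fun q : Σ n, RightCosets (Γ (n + 1)) => Odometer.cylinder q.1 q.2

theorem Odometer.isOpen_cylinder (n : ℕ) (c : RightCosets (Γ (n + 1))) :
    IsOpen (Odometer.cylinder n c) :=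
  (isOpen_discrete {c}).preimage (Odometer.continuous_coord n)

theorem Odometer.isTopologicalBasis_cylinders :
    TopologicalSpace.IsTopologicalBasis (Odometer.cylinders Γ) := by
  refine TopologicalSpace.isTopologicalBasis_of_isOpen_of_nhds ?_ fun z O hz hO => ?_
  · rintro _ ⟨q, rfl⟩
    exact Odometer.isOpen_cylinder _ _
  · obtain ⟨V, hV, rfl⟩ := isOpen_induced_iff.1 hO
    obtain ⟨F, u, hu, hsub⟩ := isOpen_pi_iff.1 hV _ hz
    -- By compatibility, the deepest coordinate in `F` determines all the others.
    refine ⟨_, ⟨⟨F.sup id, z.coord (F.sup id)⟩, rfl⟩, rfl, fun w hw => hsub fun k hk => ?_⟩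
    rw [Odometer.coord_eq_of_le (k := k) (Finset.le_sup (f := id) hk) hw]
    exact (hu k hk).2

theorem Odometer.isPiSystem_cylinders : IsPiSystem (Odometer.cylinders Γ) := by
  rintro _ ⟨⟨n, c⟩, rfl⟩ _ ⟨⟨k, d⟩, rfl⟩ ⟨z, hz, hz'⟩
  simp only [Odometer.cylinder, mem_ofPred_eq] at hz hz'
  rcases le_total n k with hnk | hkn
  · refine ⟨⟨k, d⟩, (inter_eq_right.2 fun w hw => ?_).symm⟩
    exact (Odometer.coord_eq_of_le hnk ((hw : w.coord k = d).trans hz'.symm)).trans hz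
  · refine ⟨⟨n, c⟩, (inter_eq_left.2 fun w hw => ?_).symm⟩
    exact (Odometer.coord_eq_of_le hkn ((hw : w.coord n = c).trans hz.symm)).trans hz'

theorem RightCosets.countable [Countable G] (H : Subgroup G) : Countable (RightCosets H) :=
  Function.Surjective.countable (f := RightCosets.mk H) fun c =>
    (RightCosets.exists_mk H c).imp fun _ h => h.symm

instance [Countable G] : SecondCountableTopology (Odometer Γ) := by
  have := fun n => RightCosets.countable (Γ (n + 1))
  exact Odometer.isTopologicalBasis_cylinders.secondCountableTopology (countable_range _)

theorem odometerAction_image (g : G) (S : Set (Odometer Γ)) :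
    odometerAction Γ g '' S = odometerAction Γ g⁻¹ ⁻¹' S := by
  refine congrFun (image_eq_preimage_of_inverse (fun z => ?_) (fun z => ?_)) S
  · rw [← odometerAction_mul, inv_mul_cancel, odometerAction_one]
  · rw [← odometerAction_mul, mul_inv_cancel, odometerAction_one]

/-- The group permutes the finitely many cylinders of a given depth transitively, so they share the
total mass equally. No freedom is left on a generating π-system. -/
theorem measure_cylinder [∀ n, Finite (RightCosets (Γ (n + 1)))] {μ : Measure (Odometer Γ)}
    (hμ : IsInvariantMeasure (odometerAction Γ) μ) (n : ℕ) (c : RightCosets (Γ (n + 1))) :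
    μ (Odometer.cylinder n c) = (Nat.card (RightCosets (Γ (n + 1))) : ℝ≥0∞)⁻¹ := by
  have hmeas : ∀ d : RightCosets (Γ (n + 1)), MeasurableSet (Odometer.cylinder n d) :=
    fun d => (Odometer.isOpen_cylinder n d).measurableSet
  have hconst : ∀ d, μ (Odometer.cylinder n d) = μ (Odometer.cylinder n c) := by
    intro d
    obtain ⟨a, rfl⟩ := RightCosets.exists_mk _ c
    obtain ⟨b, rfl⟩ := RightCosets.exists_mk _ d
    -- The element `a⁻¹ * b` acts on cosets by right multiplication by `b⁻¹ * a`, which takes the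
    -- coset of `b` to that of `a`.
    rw [← hμ.invariant (a⁻¹ * b) _ (hmeas _), odometerAction_image]
    congr 1
    ext z
    obtain ⟨e, he⟩ := RightCosets.exists_mk _ (z.coord n)
    have h1 : (odometerAction Γ (a⁻¹ * b)⁻¹ z).coord n =
        RightCosets.mk (Γ (n + 1)) (e * (a⁻¹ * b)) := by
      change RightCosets.translate _ _ (z.coord n) = _
      rw [he, RightCosets.translate_mk, inv_inv]
    simp only [Odometer.cylinder, mem_ofPred_eq, mem_preimage]
    rw [h1, he, RightCosets.mk_eq_mk, RightCosets.mk_eq_mk]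
    simp [mul_assoc]
  have := Fintype.ofFinite (RightCosets (Γ (n + 1)))
  have huniv : (univ : Set (Odometer Γ)) = ⋃ d, Odometer.cylinder n d := by
    ext z; simp [Odometer.cylinder]
  have h1 : μ univ = 1 := hμ.prob.measure_univ
  rw [huniv, measure_iUnion _ hmeas, tsum_fintype, Finset.sum_congr rfl fun d _ => hconst d,
    Finset.sum_const, Finset.card_univ, nsmul_eq_mul, mul_comm] at h1
  · rw [Nat.card_eq_fintype_card]
    exact ENNReal.eq_inv_of_mul_eq_one_left h1
  · intro d d' hne
    refine disjoint_left.2 fun z hz hz' => hne ?_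
    exact (show z.coord n = d from hz).symm.trans hz'

/-- The odometer is uniquely ergodic. -/
theorem isInvariantMeasure_odometer_unique [Countable G]
    [∀ n, Finite (RightCosets (Γ (n + 1)))] {μ μ' : Measure (Odometer Γ)}
    (hμ : IsInvariantMeasure (odometerAction Γ) μ)
    (hμ' : IsInvariantMeasure (odometerAction Γ) μ') : μ' = μ := by
  have := hμ.prob
  have := hμ'.prob
  refine ext_of_generate_finite (Odometer.cylinders Γ)
    (Odometer.isTopologicalBasis_cylinders.borel_eq_generateFrom)
    Odometer.isPiSystem_cylinders ?_ (by simp)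
  rintro _ ⟨⟨n, c⟩, rfl⟩
  simp only []
  rw [measure_cylinder hμ, measure_cylinder hμ']

end OdometerTheory

/-! ### Measures on the subshift and conjugacies obtained from factor maps -/

section ShiftSystem

variable {G : Type*} [Group G] {m : ℕ}

theorem isClosed_orbitClosure (y : G → Fin (m + 1)) : IsClosed (orbitClosure y) := isClosed_closure

theorem isDynamicalSystem_shiftOn [Countable G] (y : G → Fin (m + 1)) :
    IsDynamicalSystem (shiftOn y) where
  compact := isCompact_iff_compactSpace.1 (isClosed_orbitClosure y).isCompact
  metrizable := inferInstance
  one x := Subtype.ext (shift_one x.1)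
  mul g g' x := Subtype.ext (shift_mul g g' x.1)
  continuous g := ((continuous_shift g).comp continuous_subtype_val).subtype_mk _

theorem shiftOn_image (y : G → Fin (m + 1)) (g : G) (S : Set (orbitClosure y)) :
    shiftOn y g '' S = shiftOn y g⁻¹ ⁻¹' S :=
  congrFun (image_eq_preimage_of_inverse (f := shiftOn y g) (g := shiftOn y g⁻¹)
    (fun x => Subtype.ext (shift_inv_shift g x.1))
    (fun x => Subtype.ext (shift_shift_inv g x.1))) S

theorem shift_image (g : G) (S : Set (G → Fin (m + 1))) : shift g '' S = shift g⁻¹ ⁻¹' S :=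
  congrFun (image_eq_preimage_of_inverse (shift_inv_shift g) (shift_shift_inv g)) S

/-- The restriction of a shift-invariant measure to a subshift of full measure. -/
theorem isInvariantMeasure_comap [Countable G] {y : G → Fin (m + 1)}
    {ν : Measure (G → Fin (m + 1))} [IsProbabilityMeasure ν] (hν : ∀ g, ν.map (shift g) = ν)
    (hX : ν (orbitClosure y)ᶜ = 0) :
    IsInvariantMeasure (shiftOn y) (ν.comap Subtype.val) := by
  have hXm := (isClosed_orbitClosure y).measurableSet
  have hemb := MeasurableEmbedding.subtype_coe hXm
  refine ⟨⟨?_⟩, fun g A hA => ?_⟩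
  · rw [hemb.comap_apply, image_univ, Subtype.range_coe]
    exact (prob_compl_eq_zero_iff hXm).1 hX
  · rw [hemb.comap_apply, hemb.comap_apply]
    have : (Subtype.val '' (shiftOn y g '' A) : Set (G → Fin (m + 1))) =
        shift g⁻¹ ⁻¹' (Subtype.val '' A) := by
      rw [← shift_image, image_image, image_image]
      rfl
    rw [this, ← Measure.map_apply (measurable_shift g⁻¹) (hemb.measurableSet_image.2 hA), hν]

theorem IsFactorMap.isInvariantMeasure_map {y : G → Fin (m + 1)} {Γ : ℕ → Subgroup G} [Countable G]
    {π : orbitClosure y → Odometer Γ} (hπ : IsFactorMap (shiftOn y) (odometerAction Γ) π)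
    {ν : Measure (orbitClosure y)} (hν : IsInvariantMeasure (shiftOn y) ν) :
    IsInvariantMeasure (odometerAction Γ) (ν.map π) := by
  have hm := hπ.continuous.measurable
  have := hν.prob
  refine ⟨Measure.isProbabilityMeasure_map hm.aemeasurable, fun g A hA => ?_⟩
  have hA' : MeasurableSet (odometerAction Γ g '' A) := by
    rw [odometerAction_image]
    exact (continuous_odometerAction g⁻¹).measurable hA
  rw [Measure.map_apply hm hA, Measure.map_apply hm hA', ← hν.invariant g _ (hm hA),
    odometerAction_image, shiftOn_image]
  congr 1
  ext x
  simp [hπ.equivariant]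

/-- An injective restriction of a factor map to an invariant conull Borel set is a measure
conjugacy. -/
theorem IsFactorMap.isMeasureConjugacy {y : G → Fin (m + 1)} {Γ : ℕ → Subgroup G} [Countable G]
    {π : orbitClosure y → Odometer Γ} (hπ : IsFactorMap (shiftOn y) (odometerAction Γ) π)
    {ν : Measure (orbitClosure y)} {μ : Measure (Odometer Γ)} (hμ : ν.map π = μ)
    {A : Set (orbitClosure y)} (hA : MeasurableSet A) (hinv : ∀ g, shiftOn y g '' A = A)
    (hconull : ν Aᶜ = 0) (hinj : InjOn π A) :
    IsMeasureConjugacy (shiftOn y) ν (odometerAction Γ) μ A (π '' A)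
      (Equiv.Set.imageOfInjOn π A hinj) := by
  have hm := hπ.continuous.measurable
  have : StandardBorelSpace (orbitClosure y) :=
    (isClosed_orbitClosure y).measurableSet.standardBorel
  have : StandardBorelSpace A := hA.standardBorel
  -- Lusin–Souslin: an injective Borel map on a standard Borel space has Borel images. This gives
  -- measurability both of `π '' A` and of the inverse.
  have hemb : MeasurableEmbedding (fun x : A => π x) :=
    (hm.comp measurable_subtype_coe).measurableEmbedding (fun a b hab =>
      Subtype.ext (hinj a.2 b.2 hab))
  have hrange : range (fun x : A => π x) = π '' A := by
    rw [image_eq_range]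
  have himage : MeasurableSet (π '' A) := hrange ▸ hemb.measurableSet_range
  refine ⟨hA, himage, hconull, ?_, fun g => (hinv g).subset, ?_, ?_, ?_, ?_, ?_⟩
  · rw [← hμ, Measure.map_apply hm himage.compl]
    exact measure_mono_null (fun x hx hxA => hx ⟨x, hxA, rfl⟩) hconull
  · rintro g _ ⟨_, ⟨x, hx, rfl⟩, rfl⟩
    exact ⟨shiftOn y g x, (hinv g).subset ⟨x, hx, rfl⟩, hπ.equivariant g x⟩
  · exact (hm.comp measurable_subtype_coe).subtype_mk
  · intro S hS
    have : (Equiv.Set.imageOfInjOn π A hinj).symm ⁻¹' S =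
        Subtype.val ⁻¹' ((fun x : A => π x) '' S) := by
      rw [← Equiv.image_eq_preimage_symm]
      ext z
      constructor
      · rintro ⟨x, hx, rfl⟩
        exact ⟨x, hx, rfl⟩
      · rintro ⟨x, hx, he⟩
        exact ⟨x, hx, Subtype.ext he⟩
    rw [this]
    exact measurable_subtype_coe (hemb.measurableSet_image.2 hS)
  · intro B hB _
    have h1 : (Subtype.val '' {x : A | ((Equiv.Set.imageOfInjOn π A hinj) x : Odometer Γ) ∈ B}) =
        π ⁻¹' B ∩ A := by
      ext x
      constructor
      · rintro ⟨a, ha, rfl⟩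
        exact ⟨ha, a.2⟩
      · rintro ⟨hx, hxA⟩
        exact ⟨⟨x, hxA⟩, hx, rfl⟩
    rw [h1, measure_inter_conull hconull, ← hμ, Measure.map_apply hm hB]
  · exact fun g x _ => hπ.equivariant g x

end ShiftSystem

/-! ### The factor map onto the odometer and its injectivity on `A_i` -/

section Factor

variable {G : Type*} [Group G] {N : Subgroup G} {Γ : ℕ → Subgroup G} {D : ℕ → Set G} {R : Set G}
  {m : ℕ}

theorem mem_A_iff {i : Fin (m + 1)} {x : subshift Γ D R m} :
    x ∈ A Γ D R m i ↔ ∀ g, ∃ k, 1 ≤ k ∧ shift g x.1 ∈ Z Γ D R m i k := by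
  simp only [A, mem_preimage, mem_iInter, mem_iUnion, exists_prop]
  constructor
  · intro hx g
    simpa only [mem_shift_inv_image] using hx g⁻¹
  · intro hx g
    obtain ⟨k, hk, hk'⟩ := hx g⁻¹
    refine ⟨k, hk, ?_⟩
    rw [shift_image]
    exact hk'

theorem mem_Z_iff {i : Fin (m + 1)} {k : ℕ} {x : G → Fin (m + 1)} :
    x ∈ Z Γ D R m i k ↔
      ∃ v ∈ D (i + k * m - 1) * R, shift v x ∈ CSymbol Γ D R m (i + k * m - 1) i := by
  simp only [Z, mem_iUnion, exists_prop, mem_shift_inv_image]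

theorem shiftOn_image_A (i : Fin (m + 1)) (g : G) :
    shiftOn (eta Γ D R m) g '' A Γ D R m i = A Γ D R m i := by
  rw [shiftOn_image]
  ext x
  rw [mem_preimage, mem_A_iff, mem_A_iff]
  constructor
  · intro hx g'
    obtain ⟨k, hk, hk'⟩ := hx (g' * g)
    refine ⟨k, hk, ?_⟩
    rw [shiftOn, ← shift_mul, mul_inv_cancel_right] at hk'
    exact hk'
  · intro hx g'
    rw [shiftOn, ← shift_mul]
    exact hx _

/-- As `k * m ≥ 2 * k ≥ k + 1`, truncated subtraction does no harm even for `i = 0`. -/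
theorem one_le_index (hm : 2 ≤ m) (i : ℕ) {k : ℕ} (hk : 1 ≤ k) : k ≤ i + k * m - 1 := by
  have : k * 2 ≤ k * m := Nat.mul_le_mul_left k hm
  omega

namespace TilingData

variable (h : TilingData N Γ D R)
include h

theorem finite_rightCosets (n : ℕ) : Finite (RightCosets (Γ (n + 1))) := by
  have : Finite ↥(D (n + 1) * R) := h.finite_D_mul_R (by omega)
  refine Finite.of_surjective (fun u : ↥(D (n + 1) * R) => RightCosets.mk (Γ (n + 1)) u) fun c => ?_
  obtain ⟨g, rfl⟩ := RightCosets.exists_mk _ c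
  obtain ⟨γ, hγ, u, hu, rfl⟩ := h.exists_mul_D_mul_R (n := n + 1) (by omega) g
  exact ⟨⟨u, hu⟩, (RightCosets.mk_eq_mk _ _ _).2 (by simpa using hγ)⟩

/-- Both conditions select the same coset of phases in `exists_phase`, evaluated at `1`. Agreement
with `η` on a set is visibly closed and monotone in `n`, unlike equality of the sets `Per`. -/
theorem mem_C_iff (hm : 2 ≤ m) {n : ℕ} (hn : 1 ≤ n) {x : G → Fin (m + 1)} :
    x ∈ C Γ D R m n ↔ x ∈ subshift Γ D R m ∧
      EqOn x (eta Γ D R m) (periodicPart Γ D n * R) := by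
  refine ⟨fun hx => ⟨hx.1, h.eqOn_of_per_eq hn hx.2⟩, fun ⟨hx, he⟩ => ?_⟩
  obtain ⟨c, hc, hc'⟩ := h.exists_phase hm hn hx
  have h1 := hc 1
  have h2 := hc' 1
  rw [shift_one] at h1 h2
  exact h1.2 (h2.1 he)

theorem C_anti (hm : 2 ≤ m) {k n : ℕ} (hk : 1 ≤ k) (hkn : k ≤ n) :
    C Γ D R m n ⊆ C Γ D R m k := by
  intro x hx
  rw [h.mem_C_iff hm (by omega)] at hx ⊢
  exact ⟨hx.1, hx.2.mono (mul_subset_mul_right (periodicPart_mono hkn))⟩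

theorem isClosed_C (hm : 2 ≤ m) {n : ℕ} (hn : 1 ≤ n) : IsClosed (C Γ D R m n) := by
  have : C Γ D R m n = subshift Γ D R m ∩ {x | EqOn x (eta Γ D R m) (periodicPart Γ D n * R)} :=
    Set.ext fun x => h.mem_C_iff hm hn
  rw [this]
  exact (isClosed_orbitClosure _).inter (isClosed_setOf_eqOn _ _)

theorem mul_inv_mem (hm : 2 ≤ m) {n : ℕ} (hn : 1 ≤ n) {x : G → Fin (m + 1)}
    (hx : x ∈ subshift Γ D R m) {a b : G} (ha : shift a x ∈ C Γ D R m n)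
    (hb : shift b x ∈ C Γ D R m n) : a * b⁻¹ ∈ Γ n := by
  obtain ⟨c, hc, -⟩ := h.exists_phase hm hn hx
  have := mul_mem ((hc a).1 ha) (inv_mem ((hc b).1 hb))
  simpa [mul_assoc] using this

/-- The phases of a point of the subshift form a point of the odometer. -/
theorem exists_coord (hm : 2 ≤ m) (x : subshift Γ D R m) :
    ∃ z : Odometer Γ, ∀ n g, z.coord n = RightCosets.mk (Γ (n + 1)) g ↔
      shift g x.1 ∈ C Γ D R m (n + 1) := by
  choose c hc using fun n : ℕ => h.exists_phase hm (show 1 ≤ n + 1 by omega) x.2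
  have hspec : ∀ n g, RightCosets.mk (Γ (n + 1)) (c n) = RightCosets.mk (Γ (n + 1)) g ↔
      shift g x.1 ∈ C Γ D R m (n + 1) := fun n g => by
    rw [RightCosets.mk_eq_mk, (hc n).1]
  refine ⟨⟨fun n => RightCosets.mk _ (c n), fun n g hg => ?_⟩, hspec⟩
  rw [hspec] at hg ⊢
  exact h.C_anti hm (by omega) (by omega) hg

theorem isClosed_Z (hm : 2 ≤ m) (i : Fin (m + 1)) {k : ℕ} (hk : 1 ≤ k) :
    IsClosed (Z Γ D R m i k) := by
  have hn := one_le_index hm i hk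
  refine (h.finite_D_mul_R (by omega)).isClosed_biUnion fun v _ => ?_
  rw [shift_image]
  refine IsClosed.preimage (continuous_shift _) ?_
  exact (h.isClosed_C hm (by omega)).inter (isClosed_setOf_eqOn (J Γ D _ * R) fun _ => i)

theorem measurableSet_A [Countable G] (hm : 2 ≤ m) (i : Fin (m + 1)) :
    MeasurableSet (A Γ D R m i) := by
  refine measurable_subtype_coe (MeasurableSet.iInter fun g => MeasurableSet.iUnion fun k =>
    MeasurableSet.iUnion fun hk => ?_)
  rw [shift_image]
  exact measurable_shift _ (h.isClosed_Z hm i hk).measurableSet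

/-- A point outside `A_i` has a translate avoiding every `Z_{i,k}`. Such translates form a set of
mass at most `2^{-k}` for all `k`, hence null, and countably many shifts of it remain null. -/
theorem measure_compl_A [Countable G] (hm : 2 ≤ m) {i : Fin (m + 1)}
    {ν : Measure (G → Fin (m + 1))} (hν : ∀ g, ν.map (shift g) = ν)
    (hX : ν (subshift Γ D R m)ᶜ = 0)
    (hs : ∀ k, 1 ≤ k → ν (symbolSet Γ D R m k i)ᶜ ≤ 1 / 2 ^ k) :
    ν.comap Subtype.val (A Γ D R m i)ᶜ = 0 := by
  have hXm := (isClosed_orbitClosure (eta Γ D R m)).measurableSet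
  rw [(MeasurableEmbedding.subtype_coe hXm).comap_apply]
  set S : Set (G → Fin (m + 1)) := ⋂ k : ℕ, ⋂ _ : 1 ≤ k, (Z Γ D R m i k)ᶜ with hS
  have hSm : MeasurableSet S := MeasurableSet.iInter fun k => MeasurableSet.iInter fun hk =>
    (h.isClosed_Z hm i hk).measurableSet.compl
  have hS0 : ν S = 0 := by
    have key : ∀ k : ℕ, 1 ≤ k → ν S ≤ (1 / 2 : ℝ≥0∞) ^ k := by
      intro k hk
      have hn := one_le_index hm i hk
      have hsub : S ⊆ (subshift Γ D R m)ᶜ ∪ (symbolSet Γ D R m (i + k * m - 1) i)ᶜ := by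
        intro x hx
        by_contra hcon
        rw [mem_union, not_or, notMem_compl_iff, notMem_compl_iff] at hcon
        obtain ⟨hxX, v, hv, hv1, hv2⟩ := hcon
        refine mem_iInter₂.1 hx k hk (mem_Z_iff.2 ⟨v, hv, ?_, hv2⟩)
        exact (h.mem_C_iff hm (by omega)).2 ⟨shift_mem_orbitClosure _ v hxX, hv1⟩
      refine (measure_mono hsub).trans ((measure_union_le _ _).trans ?_)
      rw [hX, zero_add]
      refine (hs _ (by omega)).trans ?_
      rw [one_div, one_div, ENNReal.inv_pow]
      exact pow_le_pow_right_of_le_one' (by simp) hn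
    have hlim : Tendsto (fun k : ℕ => (1 / 2 : ℝ≥0∞) ^ k) atTop (𝓝 0) :=
      ENNReal.tendsto_pow_atTop_nhds_zero_of_lt_one (by simp [ENNReal.inv_lt_one])
    refine le_antisymm (ge_of_tendsto hlim ?_) zero_le
    filter_upwards [eventually_ge_atTop 1] with k hk using key k hk
  refine measure_mono_null (t := ⋃ g : G, shift g ⁻¹' S) ?_ ?_
  · rintro _ ⟨x, hx, rfl⟩
    rw [mem_compl_iff, mem_A_iff] at hx
    push Not at hx
    obtain ⟨g, hg⟩ := hx
    exact mem_iUnion.2 ⟨g, mem_iInter₂.2 fun k hk => hg k hk⟩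
  · refine measure_iUnion_null fun g => ?_
    rw [← Measure.map_apply (measurable_shift g) hSm, hν, hS0]

variable {π : subshift Γ D R m → Odometer Γ}
  (hπ : ∀ x n g, (π x).coord n = RightCosets.mk (Γ (n + 1)) g ↔
    shift g x.1 ∈ C Γ D R m (n + 1))
include hπ

/-- Each coordinate takes finitely many values on closed fibres, which gives continuity. A point of
the odometer prescribes a decreasing sequence of nonempty compact sets, which gives surjectivity. -/
theorem isFactorMap (hm : 2 ≤ m) :
    IsFactorMap (shiftOn (eta Γ D R m)) (odometerAction Γ) π := by
  have hclosed : ∀ n g, IsClosed {x : subshift Γ D R m | shift g x.1 ∈ C Γ D R m (n + 1)} :=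
    fun n g => (h.isClosed_C hm (by omega)).preimage
      ((continuous_shift g).comp continuous_subtype_val)
  refine ⟨?_, fun z => ?_, fun g x => ?_⟩
  · refine continuous_induced_rng.2 (continuous_pi fun n => continuous_iff_isClosed.2 fun S _ => ?_)
    have := h.finite_rightCosets n
    have hS : (fun x => (π x).coord n) ⁻¹' S = ⋃ c ∈ S, {x | (π x).coord n = c} := by
      ext x; simp
    change IsClosed ((fun x => (π x).coord n) ⁻¹' S)
    rw [hS]
    refine S.toFinite.isClosed_biUnion fun c _ => ?_
    obtain ⟨g, rfl⟩ := RightCosets.exists_mk _ c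
    simp only [hπ]
    exact hclosed n g
  · choose g hg using fun n => RightCosets.exists_mk _ (z.coord n)
    have : CompactSpace (subshift Γ D R m) :=
      isCompact_iff_compactSpace.1 (isClosed_orbitClosure _).isCompact
    have hanti : ∀ n, {x : subshift Γ D R m | shift (g (n + 1)) x.1 ∈ C Γ D R m (n + 1 + 1)} ⊆
        {x | shift (g n) x.1 ∈ C Γ D R m (n + 1)} := by
      intro n x hx
      have h1 : (π x).coord (n + 1) = z.coord (n + 1) := by
        rw [hg, hπ]; exact hx
      have h2 := Odometer.coord_eq_of_le (Nat.le_succ n) h1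
      rwa [hg n, hπ] at h2
    have hne : ∀ n, {x : subshift Γ D R m | shift (g n) x.1 ∈ C Γ D R m (n + 1)}.Nonempty := by
      intro n
      have hη : eta Γ D R m ∈ subshift Γ D R m :=
        subset_closure ⟨1, shift_one _⟩
      refine ⟨⟨_, shift_mem_orbitClosure _ (g n)⁻¹ hη⟩, ?_⟩
      rw [mem_ofPred_eq, shift_shift_inv, h.mem_C_iff hm (by omega)]
      exact ⟨hη, fun _ _ => rfl⟩
    obtain ⟨x, hx⟩ := IsCompact.nonempty_iInter_of_sequence_nonempty_isCompact_isClosed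
      _ hanti hne (hclosed 0 (g 0)).isCompact (fun n => hclosed n (g n))
    refine ⟨x, Odometer.ext (funext fun n => ?_)⟩
    rw [hg n, hπ]
    exact mem_iInter.1 hx n
  · refine Odometer.ext (funext fun n => ?_)
    obtain ⟨a, ha⟩ := RightCosets.exists_mk _ ((π x).coord n)
    change _ = RightCosets.translate _ g ((π x).coord n)
    rw [ha, RightCosets.translate_mk, hπ, shiftOn, ← shift_mul, inv_mul_cancel_right, ← hπ, ha]

/-- Equal phases let both points be viewed in the finer frame `v'`. On its periodic part both equal
`η`. Otherwise the position is a hole of order `n'`, hence also one of order `n`, so each point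
shows `i` there. -/
theorem value_of_mem_A {n n' : ℕ} (hm : 2 ≤ m) {i : Fin (m + 1)} {x y : subshift Γ D R m}
    (hxy : π x = π y) {g v v' : G} (hn : 1 ≤ n) (hnn : n ≤ n') (hv : v ∈ D n * R)
    (hv' : v' ∈ D n' * R) (hx : shift v (shift g x.1) ∈ CSymbol Γ D R m n i)
    (hy : shift v' (shift g y.1) ∈ CSymbol Γ D R m n' i) : x.1 g⁻¹ = y.1 g⁻¹ := by
  obtain ⟨k, rfl⟩ : ∃ k, n' = k + 1 := ⟨n' - 1, by omega⟩
  have hval : ∀ (z : G → Fin (m + 1)) (w : G), shift w (shift g z) w = z g⁻¹ := by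
    intro z w; simp [shift]
  have hx' : shift v' (shift g x.1) ∈ C Γ D R m (k + 1) := by
    have h1 := hy.1
    rw [← shift_mul] at h1 ⊢
    rw [← hπ] at h1 ⊢
    rwa [hxy]
  rw [← hval x.1 v', ← hval y.1 v']
  obtain ⟨d', hd', ρ', hρ', rfl⟩ := hv'
  obtain ⟨d, hd, ρ, hρ, rfl⟩ := hv
  simp only [] at *
  by_cases hU : d' ∈ periodicPart Γ D (k + 1)
  · have hmem : d' * ρ' ∈ periodicPart Γ D (k + 1) * R := ⟨d', hU, ρ', hρ', rfl⟩
    rw [((h.mem_C_iff hm (by omega)).1 hx').2 hmem, ((h.mem_C_iff hm (by omega)).1 hy.1).2 hmem]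
  · rw [hy.2 _ ⟨d', (mem_J (by omega)).2 ⟨hd', hU⟩, ρ', hρ', rfl⟩, hval, ← hval x.1 (d * ρ)]
    refine hx.2 _ ⟨d, (mem_J hn).2 ⟨hd, fun hdU => hU (periodicPart_mono hnn ?_)⟩, ρ, hρ, rfl⟩
    have hΓ := h.mul_inv_mem hm hn (shift_mem_orbitClosure _ g x.2)
      (h.C_anti hm hn hnn hx') hx.1
    -- The two frames differ by an element of `Γ n`, which preserves the periodic part of order `n`.
    have he : d' * ρ' = (d' * ρ' * (d * ρ)⁻¹) * d * ρ := by group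
    have hd'e := (h.rep_unique' (h.subset _ (by omega) hd')
      (mul_mem (h.le n hn hΓ) (h.subset n hn hd)) hρ' hρ he).1
    rw [hd'e]
    exact h.mul_mem_periodicPart hn hΓ hdU

theorem injOn_A (hm : 2 ≤ m) (i : Fin (m + 1)) : InjOn π (A Γ D R m i) := by
  intro x hx y hy hxy
  refine Subtype.ext (funext fun g => ?_)
  obtain ⟨k, hk, hxk⟩ := mem_A_iff.1 hx g⁻¹
  obtain ⟨l, hl, hyl⟩ := mem_A_iff.1 hy g⁻¹
  obtain ⟨v, hv, hv'⟩ := mem_Z_iff.1 hxk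
  obtain ⟨w, hw, hw'⟩ := mem_Z_iff.1 hyl
  have h1 := one_le_index hm i hk
  have h2 := one_le_index hm i hl
  rw [← inv_inv g]
  rcases le_total (i + k * m - 1 : ℕ) (i + l * m - 1) with hkl | hlk
  · exact h.value_of_mem_A hπ hm hxy (by omega) hkl hv hw hv' hw'
  · exact (h.value_of_mem_A hπ hm hxy.symm (by omega) hlk hw hv hw' hv').symm

end TilingData

end Factor

/-! ### Lattices and boxes in `ℤ^r` -/

section Boxes

variable {r : ℕ}

theorem mem_lattice {p : Fin r → ℕ} {x : Fin r → ℤ} :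
    x ∈ lattice p ↔ ∀ j, (p j : ℤ) ∣ x j := by
  constructor
  · intro hx j
    refine AddSubgroup.closure_induction (p := fun x _ => (p j : ℤ) ∣ x j) ?_ ?_ ?_ ?_ hx
    · rintro _ ⟨k, rfl⟩
      rcases eq_or_ne j k with rfl | hne
      · simp
      · simp [hne]
    · simp
    · exact fun x y _ _ hx hy => dvd_add hx hy
    · exact fun x _ hx => hx.neg_right
  · intro hx
    choose c hc using hx
    have : x = ∑ j, c j • Pi.single j (p j : ℤ) := by
      ext k
      simp [Finset.sum_apply, Pi.single_apply, hc k, mul_comm]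
    rw [this]
    exact sum_mem fun j _ => AddSubgroup.zsmul_mem _ (AddSubgroup.subset_closure (mem_range_self j)) _

theorem lattice_le {p p' : Fin r → ℕ} (h : ∀ j, p j ∣ p' j) : lattice p' ≤ lattice p :=
  fun _ hx => mem_lattice.2 fun j => (Int.natCast_dvd_natCast.2 (h j)).trans (mem_lattice.1 hx j)

/-- Coordinatewise division of `x j + q₁ j` by `p j`. -/
theorem exists_add_of_box {p q₁ q₂ : Fin r → ℕ} (hp : ∀ j, 0 < p j)
    (hq : ∀ j, q₁ j + q₂ j = p j) (x : Fin r → ℤ) :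
    ∃ γ ∈ lattice p, ∃ d ∈ box q₁ q₂, x = γ + d := by
  refine ⟨fun j => p j * ((x j + q₁ j) / p j), mem_lattice.2 fun j => dvd_mul_right _ _,
    fun j => (x j + q₁ j) % p j - q₁ j, fun j => ?_, ?_⟩
  · have h1 := Int.emod_nonneg (x j + q₁ j) (b := p j) (by have := hp j; omega)
    have h2 := Int.emod_lt_of_pos (x j + q₁ j) (b := p j) (by have := hp j; omega)
    have := hq j
    constructor
    · simp only; omega
    · simp only; omega
  · ext j
    have := Int.mul_ediv_add_emod (x j + q₁ j) (p j)
    simp only [Pi.add_apply]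
    linarith

theorem box_unique {p q₁ q₂ : Fin r → ℕ} (hq : ∀ j, q₁ j + q₂ j = p j) {d d' : Fin r → ℤ}
    (hd : d ∈ box q₁ q₂) (hd' : d' ∈ box q₁ q₂) (h : d - d' ∈ lattice p) : d = d' := by
  ext j
  have h1 := mem_lattice.1 h j
  have h2 := hd j
  have h3 := hd' j
  have h4 := hq j
  have := Int.eq_zero_of_abs_lt_dvd h1 (by rw [Pi.sub_apply, abs_lt]; constructor <;> omega)
  rw [Pi.sub_apply] at this
  omega

theorem box_eq_piFinset (q₁ q₂ : Fin r → ℕ) :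
    box q₁ q₂ = (Fintype.piFinset fun j => Finset.Ico (-(q₁ j : ℤ)) (q₂ j)) := by
  ext x; simp [box]

theorem finite_box (q₁ q₂ : Fin r → ℕ) : (box q₁ q₂).Finite := by
  rw [box_eq_piFinset]; exact Finset.finite_toSet _

/-- The box represents every class modulo `lattice p'`, and representatives of points of `lattice p`
stay in `lattice p`. -/
theorem relIndex_le_ncard {p p' q₁ q₂ : Fin r → ℕ} (hp : ∀ j, 0 < p' j)
    (hq : ∀ j, q₁ j + q₂ j = p' j) (h : ∀ j, p j ∣ p' j) :
    (lattice p').relIndex (lattice p) ≤ (box q₁ q₂ ∩ lattice p).ncard := by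
  have : Finite ↥(box q₁ q₂ ∩ lattice p : Set (Fin r → ℤ)) :=
    (finite_box q₁ q₂).subset inter_subset_left
  rw [AddSubgroup.relIndex, AddSubgroup.index, ← Nat.card_coe_set_eq]
  refine Nat.card_le_card_of_surjective
    (fun x : ↥(box q₁ q₂ ∩ lattice p : Set (Fin r → ℤ)) =>
      ((⟨x.1, x.2.2⟩ : lattice p) : lattice p ⧸ (lattice p').addSubgroupOf (lattice p)))
    fun c => ?_
  obtain ⟨⟨x, hx⟩, rfl⟩ := QuotientAddGroup.mk_surjective c
  obtain ⟨γ, hγ, d, hd, rfl⟩ := exists_add_of_box hp hq x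
  have hdp : d ∈ lattice p := by
    simpa using add_mem (neg_mem (lattice_le h hγ)) hx
  refine ⟨⟨d, hd, hdp⟩, QuotientAddGroup.eq.2 ?_⟩
  rw [AddSubgroup.mem_addSubgroupOf]
  simpa [add_comm γ d] using hγ

/-- Leaving the box in direction `j` confines the `j`-th coordinate to a strip of width at most `|v
j|`; the other coordinates are only bounded by the box. -/
theorem card_box_boundary_le (q₁ q₂ : Fin r → ℕ) (v : Fin r → ℤ) (j : Fin r) :
    (q₁ j + q₂ j) * {d ∈ box q₁ q₂ | ¬(-(q₁ j : ℤ) ≤ v j + d j ∧ v j + d j < q₂ j)}.ncard ≤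
      (v j).natAbs * (box q₁ q₂).ncard := by
  classical
  set I : Fin r → Finset ℤ := fun j => Finset.Ico (-(q₁ j : ℤ)) (q₂ j) with hI
  set T : Finset ℤ := (I j).filter fun t => ¬(-(q₁ j : ℤ) ≤ v j + t ∧ v j + t < q₂ j) with hT
  have hset : {d ∈ box q₁ q₂ | ¬(-(q₁ j : ℤ) ≤ v j + d j ∧ v j + d j < q₂ j)} ⊆
      (Fintype.piFinset (Function.update I j T) : Finset (Fin r → ℤ)) := by
    rintro d ⟨hd, hd'⟩
    rw [Finset.mem_coe, Fintype.mem_piFinset]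
    intro k
    rcases eq_or_ne k j with rfl | hne
    · rw [Function.update_self, hT, Finset.mem_filter, hI, Finset.mem_Ico]
      exact ⟨hd k, hd'⟩
    · rw [Function.update_of_ne hne, hI, Finset.mem_Ico]
      exact hd k
  have hTcard : T.card ≤ (v j).natAbs := by
    have : T ⊆ if 0 ≤ v j then Finset.Ico ((q₂ j : ℤ) - v j) (q₂ j)
        else Finset.Ico (-(q₁ j : ℤ)) (-(q₁ j : ℤ) - v j) := by
      intro t ht
      rw [hT, Finset.mem_filter, hI, Finset.mem_Ico] at ht
      split_ifs <;> rw [Finset.mem_Ico] <;> omega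
    refine (Finset.card_le_card this).trans ?_
    split_ifs <;> rw [Int.card_Ico] <;> omega
  have h1 := Set.ncard_le_ncard hset (Finset.finite_toSet _)
  rw [Set.ncard_coe_finset, Fintype.card_piFinset] at h1
  have h2 : (box q₁ q₂).ncard = ∏ k, (I k).card := by
    rw [box_eq_piFinset, Set.ncard_coe_finset, Fintype.card_piFinset]
  have h3 : (I j).card = q₁ j + q₂ j := by
    rw [hI, Int.card_Ico]; omega
  rw [← Finset.mul_prod_erase _ _ (Finset.mem_univ j), Function.update_self] at h1
  rw [h2, ← Finset.mul_prod_erase _ _ (Finset.mem_univ j), h3]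
  have h4 : ∏ k ∈ Finset.univ.erase j, (Function.update I j T k).card =
      ∏ k ∈ Finset.univ.erase j, (I k).card :=
    Finset.prod_congr rfl fun k hk => by rw [Function.update_of_ne (Finset.ne_of_mem_erase hk)]
  rw [h4] at h1
  calc (q₁ j + q₂ j) * _ ≤ (q₁ j + q₂ j) * (T.card * _) := Nat.mul_le_mul_left _ h1
    _ ≤ (q₁ j + q₂ j) * ((v j).natAbs * _) :=
      Nat.mul_le_mul_left _ (Nat.mul_le_mul_right _ hTcard)
    _ = _ := by ring

theorem card_box_diff_le {q₁ q₂ : Fin r → ℕ} (v : Fin r → ℤ) {n : ℕ}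
    (hn : ∀ j, n ≤ q₁ j + q₂ j) :
    n * {d ∈ box q₁ q₂ | v + d ∉ box q₁ q₂}.ncard ≤ (∑ j, (v j).natAbs) * (box q₁ q₂).ncard := by
  set S : Fin r → Set (Fin r → ℤ) := fun j =>
    {d ∈ box q₁ q₂ | ¬(-(q₁ j : ℤ) ≤ v j + d j ∧ v j + d j < q₂ j)} with hS
  have hsub : {d ∈ box q₁ q₂ | v + d ∉ box q₁ q₂} ⊆ ⋃ j ∈ Finset.univ, S j := by
    rintro d ⟨hd, hd'⟩
    simp only [box, mem_ofPred_eq, not_forall, Pi.add_apply] at hd'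
    obtain ⟨j, hj⟩ := hd'
    exact mem_biUnion (Finset.mem_univ j) ⟨hd, hj⟩
  have h1 := (Set.ncard_le_ncard hsub ((finite_box q₁ q₂).subset
    (iUnion₂_subset fun j _ => sep_subset _ _))).trans (Finset.set_ncard_biUnion_le _ _)
  refine (Nat.mul_le_mul_left _ h1).trans ?_
  rw [Finset.mul_sum, Finset.sum_mul]
  exact Finset.sum_le_sum fun j _ =>
    (Nat.mul_le_mul_right _ (hn j)).trans (card_box_boundary_le q₁ q₂ v j)

/-- With `t = 2^{-n}`, the inequality `2^{-t} ≥ 1 - t`, from `exp s ≥ 1 + s` and `log 2 ≤ 1`, bounds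
the left side below by `1 / t`. -/
theorem two_pow_le_of_index {K n : ℕ}
    (h : 1 / (1 - 1 / (2 : ℝ) ^ ((1 / 2 : ℝ) ^ n)) < (K : ℝ)) : 2 ^ n ≤ K := by
  set t : ℝ := (1 / 2 : ℝ) ^ n with ht
  have ht0 : 0 < t := by positivity
  have h1 : (1 : ℝ) < 2 ^ t := Real.one_lt_rpow (by norm_num) ht0
  have h2 : 1 / (2 : ℝ) ^ t < 1 := by
    rw [div_lt_one (by linarith)]; exact h1
  have h3 : 1 - t ≤ 1 / (2 : ℝ) ^ t := by
    rw [one_div, ← Real.rpow_neg (by norm_num), Real.rpow_def_of_pos (by norm_num)]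
    have h4 := Real.add_one_le_exp (Real.log 2 * -t)
    have h5 : Real.log 2 ≤ 1 := by
      have := Real.log_le_sub_one_of_pos (x := 2) (by norm_num)
      linarith
    nlinarith
  have h6 : (2 : ℝ) ^ n ≤ 1 / (1 - 1 / (2 : ℝ) ^ t) := by
    have h7 : (2 : ℝ) ^ n = 1 / t := by
      rw [ht, one_div_pow, one_div_one_div]
    rw [h7]
    exact one_div_le_one_div_of_le (by linarith) (by linarith)
  exact_mod_cast (h6.trans h.le)

end Boxes

/-! ### Transfer from `ℤ^r` to `G` and the choice of indices -/

section Setting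

variable {G : Type*} [Group G] {N : Subgroup G} {r : ℕ}

theorem tilingData_of_isAdmissible [N.Normal] [N.FiniteIndex] (hr : 1 ≤ r)
    (e : Multiplicative (Fin r → ℤ) ≃* N) {R : Set G}
    (hR : Set.BijOn (QuotientGroup.mk : G → G ⧸ N) R Set.univ) (h1R : (1 : G) ∈ R)
    {p q₁ q₂ : ℕ → Fin r → ℕ} (hpq : IsAdmissible p q₁ q₂)
    {Γ : ℕ → Subgroup G} (hΓ : ∀ i, 1 ≤ i → Γ i = liftSubgroup e (lattice (p i)))
    {D : ℕ → Set G} (hD : ∀ i, 1 ≤ i → D i = liftSet e (box (q₁ i) (q₂ i))) :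
    TilingData N Γ D R := by
  obtain ⟨ι, hι⟩ : ∃ ι : (Fin r → ℤ) → G, ι = fun x => (e (Multiplicative.ofAdd x) : G) := ⟨_, rfl⟩
  have hadd : ∀ x y, ι (x + y) = ι x * ι y := fun x y => by simp [hι, ofAdd_add]
  have hneg : ∀ x, ι (-x) = (ι x)⁻¹ := fun x => by simp [hι, ofAdd_neg]
  have hzero : ι 0 = 1 := by simp [hι]
  have hinj : Function.Injective ι := fun x y hxy => by
    simpa [hι] using hxy
  have hmem : ∀ x, ι x ∈ N := fun x => by simp [hι]
  have hsurj : ∀ g ∈ N, ∃ x, ι x = g := fun g hg =>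
    ⟨Multiplicative.toAdd (e.symm ⟨g, hg⟩), by simp [hι]⟩
  have hΓ' : ∀ n, 1 ≤ n → ∀ g, g ∈ Γ n ↔ ∃ x ∈ lattice (p n), ι x = g := by
    intro n hn g
    rw [hΓ n hn, liftSubgroup, Subgroup.mem_map]
    constructor
    · rintro ⟨x, hx, rfl⟩
      exact ⟨Multiplicative.toAdd x, hx, by simp [hι]⟩
    · rintro ⟨x, hx, rfl⟩
      exact ⟨Multiplicative.ofAdd x, hx, by simp [hι]⟩
  have hΓι : ∀ n, 1 ≤ n → ∀ x, ι x ∈ Γ n ↔ x ∈ lattice (p n) := by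
    intro n hn x
    rw [hΓ' n hn]
    exact ⟨fun ⟨y, hy, he⟩ => hinj he ▸ hy, fun hx => ⟨x, hx, rfl⟩⟩
  have hD' : ∀ n, 1 ≤ n → D n = ι '' box (q₁ n) (q₂ n) := fun n hn => by
    rw [hD n hn, liftSet, hι]
  have hDι : ∀ n, 1 ≤ n → ∀ x, ι x ∈ D n ↔ x ∈ box (q₁ n) (q₂ n) := fun n hn x => by
    rw [hD' n hn, hinj.mem_set_image]
  have hp : ∀ n, 1 ≤ n → ∀ j, 0 < p n j := fun n hn j => by
    have := hpq.lt_period n hn j; omega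
  have htile : ∀ n, 1 ≤ n → ∀ x, x ∈ box (q₁ (n + 1)) (q₂ (n + 1)) ↔
      ∃ γ ∈ lattice (p n), γ ∈ box (q₁ (n + 1)) (q₂ (n + 1)) ∧ ∃ d ∈ box (q₁ n) (q₂ n),
        x = γ + d := by
    intro n hn x
    conv_lhs => rw [hpq.tiling n hn]
    simp only [mem_iUnion, mem_inter_iff, mem_image, exists_prop, SetLike.mem_coe]
    constructor
    · rintro ⟨γ, ⟨h1, h2⟩, d, hd, rfl⟩
      exact ⟨γ, h2, h1, d, hd, rfl⟩
    · rintro ⟨γ, h2, h1, d, hd, rfl⟩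
      exact ⟨γ, ⟨h1, h2⟩, d, hd, rfl⟩
  have hnormal : N.Normal := inferInstance
  have hfinR : R.Finite := hR.finite_iff_finite.2 (Set.toFinite _)
  refine ⟨hnormal, ?_, h1R, hfinR, ?_, ?_, ?_, ?_, ?_, ?_, ?_, ?_, ?_, ?_, ?_, ?_, ?_, ?_, ?_⟩
  · intro g hg g' hg'
    obtain ⟨x, rfl⟩ := hsurj g hg
    obtain ⟨y, rfl⟩ := hsurj g' hg'
    rw [← hadd, ← hadd, add_comm]
  · intro g
    obtain ⟨ρ, hρ, he⟩ := hR.surjOn (mem_univ (g : G ⧸ N))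
    refine ⟨g * ρ⁻¹, ?_, ρ, hρ, by group⟩
    have := hnormal.conj_mem _ (QuotientGroup.eq.1 he) ρ
    simpa [mul_assoc] using this
  · intro ρ hρ ρ' hρ' hmem
    refine hR.injOn hρ hρ' (QuotientGroup.eq.2 ?_)
    have := hnormal.conj_mem _ (inv_mem hmem) ρ⁻¹
    simpa [mul_assoc] using this
  · intro n hn g hg
    obtain ⟨x, -, rfl⟩ := (hΓ' n hn g).1 hg
    exact hmem x
  · intro n hn g hg
    obtain ⟨x, hx, rfl⟩ := (hΓ' (n + 1) (by omega) g).1 hg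
    exact (hΓι n hn x).2 (lattice_le (hpq.dvd_succ n hn) hx)
  · intro n hn
    rw [hD' n hn]
    rintro _ ⟨x, -, rfl⟩
    exact hmem x
  · intro n hn
    rw [hD' n hn]
    exact (finite_box _ _).image _
  · intro n hn
    rw [← hzero, hDι n hn]
    intro j
    have := hpq.lt_right n hn j
    constructor <;> simp only [Pi.zero_apply] <;> omega
  · intro n hn g hg
    obtain ⟨x, rfl⟩ := hsurj g hg
    obtain ⟨γ, hγ, d, hd, rfl⟩ := exists_add_of_box (hp n hn) (hpq.add_eq n hn) x
    exact ⟨ι γ, (hΓι n hn γ).2 hγ, ι d, (hDι n hn d).2 hd, hadd _ _⟩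
  · intro n hn g hg g' hg' hgg
    rw [hD' n hn] at hg hg'
    obtain ⟨x, hx, rfl⟩ := hg
    obtain ⟨y, hy, rfl⟩ := hg'
    rw [← hneg, ← hadd, ← sub_eq_add_neg, hΓι n hn] at hgg
    rw [box_unique (hpq.add_eq n hn) hx hy hgg]
  · intro n hn g hg
    rw [hD' (n + 1) (by omega)] at hg
    obtain ⟨x, hx, rfl⟩ := hg
    obtain ⟨γ, hγ, hγ', d, hd, rfl⟩ := (htile n hn x).1 hx
    exact ⟨ι γ, (hΓι n hn γ).2 hγ, (hDι _ (by omega) γ).2 hγ', ι d, (hDι n hn d).2 hd, hadd _ _⟩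
  · intro n hn g hg hg' g' hgg
    obtain ⟨γ, hγ, rfl⟩ := (hΓ' n hn g).1 hg
    rw [hD' n hn] at hgg
    obtain ⟨d, hd, rfl⟩ := hgg
    rw [← hadd, hDι _ (by omega)]
    exact (htile n hn _).2 ⟨γ, hγ, (hDι _ (by omega) γ).1 hg', d, hd, rfl⟩
  · intro g hg
    obtain ⟨x, rfl⟩ := hsurj g hg
    -- Both half-widths of the box exceed its index, so an index above the `ℓ¹` norm suffices.
    refine ⟨∑ j, (x j).natAbs + 1, by omega, (hDι _ (by omega) x).2 fun j => ?_⟩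
    have h1 := hpq.lt_left (∑ j, (x j).natAbs + 1) (by omega) j
    have h2 := hpq.lt_right (∑ j, (x j).natAbs + 1) (by omega) j
    have h3 : (x j).natAbs ≤ ∑ j, (x j).natAbs :=
      Finset.single_le_sum (f := fun j => (x j).natAbs) (fun _ _ => Nat.zero_le _)
        (Finset.mem_univ j)
    omega
  -- The all-ones vector fits because `q₂ 1 j > 1`; it is nonzero because `r ≥ 1`.
  · refine ⟨ι fun _ => 1, (hDι 1 le_rfl _).2 fun j => ?_, fun hc => ?_⟩
    · have := hpq.lt_right 1 le_rfl j
      constructor <;> omega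
    · rw [← hzero] at hc
      have := congrFun (hinj hc) ⟨0, hr⟩
      simp at this
  · intro n hn
    have h1 := two_pow_le_of_index (hpq.index n hn)
    have h2 := relIndex_le_ncard (hp (n + 1) (by omega)) (hpq.add_eq (n + 1) (by omega))
      (hpq.dvd_succ n hn)
    have h3 : D (n + 1) ∩ Γ n = ι '' (box (q₁ (n + 1)) (q₂ (n + 1)) ∩ lattice (p n)) := by
      ext g
      rw [mem_inter_iff, hD' (n + 1) (by omega)]
      constructor
      · rintro ⟨⟨x, hx, rfl⟩, hx'⟩
        exact ⟨x, ⟨hx, (hΓι n hn x).1 hx'⟩, rfl⟩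
      · rintro ⟨x, ⟨hx, hx'⟩, rfl⟩
        exact ⟨⟨x, hx, rfl⟩, (hΓι n hn x).2 hx'⟩
    rw [h3, Set.ncard_image_of_injective _ hinj]
    exact h1.trans h2
  · intro g hg
    obtain ⟨v, rfl⟩ := hsurj g hg
    refine ⟨∑ j, (v j).natAbs, fun n hn => ?_⟩
    have h1 : {d ∈ D n | ι v * d ∉ D n} =
        ι '' {d ∈ box (q₁ n) (q₂ n) | v + d ∉ box (q₁ n) (q₂ n)} := by
      ext g
      constructor
      · rintro ⟨hg, hg'⟩
        rw [hD' n hn] at hg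
        obtain ⟨x, hx, rfl⟩ := hg
        rw [← hadd, hDι n hn] at hg'
        exact ⟨x, ⟨hx, hg'⟩, rfl⟩
      · rintro ⟨x, ⟨hx, hx'⟩, rfl⟩
        refine ⟨(hDι n hn x).2 hx, ?_⟩
        rwa [← hadd, hDι n hn]
    rw [h1, hD' n hn, Set.ncard_image_of_injective _ hinj, Set.ncard_image_of_injective _ hinj]
    refine card_box_diff_le v fun j => ?_
    have h2 := hpq.lt_left n hn j
    omega

end Setting

theorem tendsto_index {m : ℕ} (hm : 2 ≤ m) (i : ℕ) :
    Tendsto (fun s : ℕ => i + s * m - 1) atTop atTop := by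
  refine tendsto_atTop_mono' atTop ?_ tendsto_id
  filter_upwards [eventually_ge_atTop 1] with s hs using one_le_index hm i hs

theorem symbol_index {m : ℕ} (hm : 2 ≤ m) {i : Fin (m + 1)} (hi : i ≠ 0) (s : ℕ) :
    symbol m (i + s * m - 1 + 1) = i := by
  have h0 : (i : ℕ) ≠ 0 := fun hc => hi (Fin.ext hc)
  have h1 := i.2
  apply Fin.ext
  rw [symbol_val hm, show (i : ℕ) + s * m - 1 + 1 - 1 = (i - 1) + s * m by omega,
    Nat.add_mul_mod_self_right, Nat.mod_eq_of_lt (by omega)]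
  omega

end Toeplitz

/-- Each limit measure `ν_i` on the Toeplitz subshift generated by `η` makes it measure conjugate
to the odometer with its unique invariant measure, through the restriction of the factor map `π`
to the invariant set `A_i` of full measure. -/
theorem proposition4p25
    {G : Type*} [Group G] [Countable G]
    -- a finite index normal subgroup isomorphic to `ℤ^r`
    (N : Subgroup G) [N.Normal] [N.FiniteIndex]
    (r : ℕ) (hr : 1 ≤ r) (e : Multiplicative (Fin r → ℤ) ≃* N)
    -- representatives of `G / N`
    (R : Set G) (hR : Set.BijOn (QuotientGroup.mk : G → G ⧸ N) R Set.univ)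
    (h1R : (1 : G) ∈ R)
    -- the subgroups `Γ_i` and their fundamental domains `D_i`
    (p q₁ q₂ : ℕ → Fin r → ℕ) (hpq : Toeplitz.IsAdmissible p q₁ q₂)
    (Γ : ℕ → Subgroup G) (hΓ : ∀ i, 1 ≤ i → Γ i = Toeplitz.liftSubgroup e (Toeplitz.lattice (p i)))
    (D : ℕ → Set G) (hD : ∀ i, 1 ≤ i → D i = Toeplitz.liftSet e (Toeplitz.box (q₁ i) (q₂ i)))
    (m : ℕ) (hm : 2 ≤ m) :
    ∃ π : Toeplitz.subshift Γ D R m → Toeplitz.Odometer Γ,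
      -- `π` is the factor map onto the odometer
      Toeplitz.IsFactorMap (Toeplitz.shiftOn (Toeplitz.eta Γ D R m)) (Toeplitz.odometerAction Γ) π ∧
      (∀ x n g, (π x).coord n = Toeplitz.RightCosets.mk (Γ (n + 1)) g ↔
        (x : G → Fin (m + 1)) ∈ Toeplitz.shift g⁻¹ '' Toeplitz.C Γ D R m (n + 1)) ∧
      -- `μ` is the unique invariant measure of the odometer
      ∃ μ : Measure (Toeplitz.Odometer Γ),
        Toeplitz.IsPMPSystem (Toeplitz.odometerAction Γ) μ ∧
        (∀ μ' : Measure (Toeplitz.Odometer Γ),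
          Toeplitz.IsInvariantMeasure (Toeplitz.odometerAction Γ) μ' → μ' = μ) ∧
        ∀ i : Fin (m + 1), i ≠ 0 →
          (∃ ν : ProbabilityMeasure (G → Fin (m + 1)), Toeplitz.IsWeakLimitPoint
            (fun s : ℕ => Toeplitz.periodicMeasure Γ D R m (i + s * m - 1)) ν) ∧
          ∀ ν : ProbabilityMeasure (G → Fin (m + 1)), Toeplitz.IsWeakLimitPoint
            (fun s : ℕ => Toeplitz.periodicMeasure Γ D R m (i + s * m - 1)) ν →
            -- `νX` is `ν` as a measure on the subshift
            ∀ νX : Measure (Toeplitz.subshift Γ D R m),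
              νX = (ν : Measure (G → Fin (m + 1))).comap Subtype.val →
              Toeplitz.IsPMPSystem (Toeplitz.shiftOn (Toeplitz.eta Γ D R m)) νX ∧
              MeasurableSet (Toeplitz.A Γ D R m i) ∧
              (∀ g, Toeplitz.shiftOn (Toeplitz.eta Γ D R m) g '' Toeplitz.A Γ D R m i =
                Toeplitz.A Γ D R m i) ∧
              νX (Toeplitz.A Γ D R m i) = 1 ∧
              Set.InjOn π (Toeplitz.A Γ D R m i) ∧
              Toeplitz.MeasureConjugate (Toeplitz.shiftOn (Toeplitz.eta Γ D R m)) νX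
                (Toeplitz.odometerAction Γ) μ ∧
              ∃ f : ↥(Toeplitz.A Γ D R m i) ≃ ↥(π '' Toeplitz.A Γ D R m i),
                (∀ x, (f x : Toeplitz.Odometer Γ) = π x) ∧
                Toeplitz.IsMeasureConjugacy (Toeplitz.shiftOn (Toeplitz.eta Γ D R m)) νX
                  (Toeplitz.odometerAction Γ) μ (Toeplitz.A Γ D R m i)
                  (π '' Toeplitz.A Γ D R m i) f := by
  have h := Toeplitz.tilingData_of_isAdmissible hr e hR h1R hpq hΓ hD
  choose π hπ using h.exists_coord (m := m) hm
  have hfactor := h.isFactorMap hπ hm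
  have hfin := h.finite_rightCosets
  have hlim : ∀ i : Fin (m + 1), ∃ ν : ProbabilityMeasure (G → Fin (m + 1)),
      Toeplitz.IsWeakLimitPoint
        (fun s : ℕ => Toeplitz.periodicMeasure Γ D R m (i + s * m - 1)) ν := fun i => by
    refine Toeplitz.exists_isWeakLimitPoint ?_
    filter_upwards [(Toeplitz.tendsto_index hm i).eventually_ge_atTop 1] with s hs
    exact h.isProbabilityMeasure_periodicMeasure hs
  have hinv : ∀ (i : Fin (m + 1)) (ν : ProbabilityMeasure (G → Fin (m + 1))),
      Toeplitz.IsWeakLimitPoint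
        (fun s : ℕ => Toeplitz.periodicMeasure Γ D R m (i + s * m - 1)) ν →
      Toeplitz.IsInvariantMeasure (Toeplitz.shiftOn (Toeplitz.eta Γ D R m))
        ((ν : Measure (G → Fin (m + 1))).comap Subtype.val) := fun i ν hν =>
    Toeplitz.isInvariantMeasure_comap
      (h.map_shift_of_isWeakLimitPoint (Toeplitz.tendsto_index hm i) hν)
      (h.measure_compl_subshift (Toeplitz.tendsto_index hm i) hν)
  -- Existence and invariance of limits hold for every `i`, including `0`, so the image of any one
  -- of them serves as `μ`.
  obtain ⟨ν₀, hν₀⟩ := hlim 0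
  have hsys := Toeplitz.isDynamicalSystem_shiftOn (Toeplitz.eta Γ D R m)
  have hμ := hfactor.isInvariantMeasure_map (hinv 0 ν₀ hν₀)
  have : CompactSpace (Toeplitz.Odometer Γ) := by
    have := hsys.compact
    exact hfactor.surjective.compactSpace hfactor.continuous
  refine ⟨π, hfactor, fun x n g => ?_, _, ⟨⟨‹_›, inferInstance, Toeplitz.odometerAction_one,
    Toeplitz.odometerAction_mul, Toeplitz.continuous_odometerAction⟩, hμ⟩,
    fun μ' hμ' => Toeplitz.isInvariantMeasure_odometer_unique hμ hμ', fun i hi => ⟨hlim i, ?_⟩⟩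
  · rw [hπ, Toeplitz.mem_shift_inv_image]
  rintro ν hν _ rfl
  have ha := Toeplitz.tendsto_index hm i
  have hνinv := hinv i ν hν
  have hA := h.measurableSet_A hm i
  have hconull := h.measure_compl_A hm (h.map_shift_of_isWeakLimitPoint ha hν)
    (h.measure_compl_subshift ha hν) fun k hk => h.measure_compl_symbolSet_le ha hν
      (Eventually.of_forall fun s => Toeplitz.symbol_index hm hi s) hk
  have hinj := h.injOn_A hπ hm i
  -- Unique ergodicity identifies the image of `ν` with the measure `μ` built from `ν₀`.
  have hconj := hfactor.isMeasureConjugacy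
    (Toeplitz.isInvariantMeasure_odometer_unique hμ (hfactor.isInvariantMeasure_map hνinv))
    hA (Toeplitz.shiftOn_image_A i) hconull hinj
  have := hνinv.prob
  exact ⟨⟨hsys, hνinv⟩, hA, Toeplitz.shiftOn_image_A i, (prob_compl_eq_zero_iff hA).1 hconull,
    hinj, ⟨_, _, _, hconj⟩, Equiv.Set.imageOfInjOn π _ hinj, fun _ => rfl, hconj⟩
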